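/- Let $G$ be a finite group with a BN-pair $(B,N)$ of rank $n+1$ ($n\ge 0$), that is: $B,N$ are subgroups generating $G$, $B\cap N$ is normal in $N$, and the Weyl group $W=N/(B\cap N)$ is generated by a set $\mathfrak S$ of $n+1$ elements of order $2$ such that $sBw\subseteq BswB\cup BwB$ and $sBs^{-1}\not\subseteq B$ for all $s\in\mathfrak S$, $w\in W$. For $J\subseteq\mathfrak S$ let $G_J=B\langle J\rangle B$ be the standard parabolic subgroup, and for $s\in\mathfrak S$ let $(s)=\mathfrak S\setminus\{s\}$. Let $\Delta=\Delta(G;B,N)$ be the associated spherical building: the $n$-dimensional simplicial complex on the vertex set $V=\bigsqcup_{s\in\mathfrak S}G/G_{(s)}$ whose maximal faces are the chambers $C_g=\{gG_{(s)}:s\in\mathfrak S\}$, $g\in G$. For $g\in G$ let the apartment $A_g$ be the subcomplex of $\Delta$ induced on the vertex set $V_g=\{gwG_{(s)}:w\in W,\ s\in\mathfrak S\}$. Let $k\ge 1$, let $g_1,\dots,g_k\in G$ and let $Y=\bigcap_{i=1}^k A_{g_i}$. If $\dim Y=n$, then the reduced simplicial homology with $\mathbb F_2$ coefficients satisfies $\tilde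 H_i(Y;\mathbb F_2)=0$ for all integers $i\le n-1$. -/

import Mathlib

universe u

/-- A BN-pair (Tits system) in a group `G`: subgroups `B`, `N` generating `G` such that `B ∩ N` is
normal in `N`, together with the distinguished set `S` of generators of the Weyl group
`W = N / (B ∩ N)`. The subgroup `B.subgroupOf N` is `B ∩ N` regarded as a subgroup of `N`. -/
structure BNPair (G : Type u) [Group G] where
  B : Subgroup G
  N : Subgroup G
  sup_eq_top : B ⊔ N = ⊤
  normal : (B.subgroupOf N).Normal
  S : Set (N ⧸ B.subgroupOf N)
  closure_S : Subgroup.closure S = ⊤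
  orderOf_S : ∀ s ∈ S, orderOf s = 2
  /-- `s B w ⊆ B s w B ∪ B w B` for `s ∈ S` and `w ∈ W`. -/
  mul_mem : ∀ s w : N, (s : N ⧸ B.subgroupOf N) ∈ S → ∀ b ∈ B,
    (s : G) * b * (w : G) ∈
      DoubleCoset.doubleCoset ((s : G) * (w : G)) (B : Set G) (B : Set G) ∪
        DoubleCoset.doubleCoset (w : G) (B : Set G) (B : Set G)
  /-- `s B s⁻¹ ⊄ B` for `s ∈ S`. -/
  not_le : ∀ s : N, (s : N ⧸ B.subgroupOf N) ∈ S → ∃ b ∈ B, (s : G) * b * (s : G)⁻¹ ∉ B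

namespace BNPair

variable {G : Type u} [Group G] (P : BNPair G)

/-- The Weyl group `W = N / (B ∩ N)`. -/
abbrev Weyl : Type u := P.N ⧸ P.B.subgroupOf P.N

instance : (P.B.subgroupOf P.N).Normal := P.normal

/-- The rank of a BN-pair: the number of distinguished generators. -/
noncomputable def rank : ℕ := Nat.card P.S

/-- The subgroup `W_J = ⟨J⟩` of the Weyl group, for `J ⊆ S`. -/
def weylParabolic (J : Set P.S) : Subgroup P.Weyl :=
  Subgroup.closure (Subtype.val '' J)

/-- The set `B W_J B`, for `J ⊆ S`. -/
def parabolicSet (J : Set P.S) : Set G :=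
  {x | ∃ w : P.N, (w : P.Weyl) ∈ P.weylParabolic J ∧
    x ∈ DoubleCoset.doubleCoset (w : G) (P.B : Set G) (P.B : Set G)}

theorem mul_mem_parabolicSet_of_B (J : Set P.S) {b x : G} (hb : b ∈ P.B)
    (hx : x ∈ P.parabolicSet J) : b * x ∈ P.parabolicSet J := by
  obtain ⟨w, hw, h⟩ := hx
  obtain ⟨c, hc, d, hd, rfl⟩ := DoubleCoset.mem_doubleCoset.1 h
  exact ⟨w, hw, DoubleCoset.mem_doubleCoset.2
    ⟨b * c, P.B.mul_mem hb hc, d, hd, by simp only [mul_assoc]⟩⟩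

theorem mul_mem_parabolicSet_of_gen (J : Set P.S) {s : P.N}
    (hs : (s : P.Weyl) ∈ Subtype.val '' J) {x : G} (hx : x ∈ P.parabolicSet J) :
    (s : G) * x ∈ P.parabolicSet J := by
  obtain ⟨w, hw, h⟩ := hx
  obtain ⟨c, hc, d, hd, rfl⟩ := DoubleCoset.mem_doubleCoset.1 h
  have hsS : (s : P.Weyl) ∈ P.S := by
    obtain ⟨t, -, ht⟩ := hs
    rw [← ht]; exact t.2
  rcases P.mul_mem s w hsS c hc with h' | h'
  · obtain ⟨e, he, f, hf, hef⟩ := DoubleCoset.mem_doubleCoset.1 h'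
    refine ⟨s * w, ?_, DoubleCoset.mem_doubleCoset.2
      ⟨e, he, f * d, P.B.mul_mem hf hd, ?_⟩⟩
    · exact (P.weylParabolic J).mul_mem (Subgroup.subset_closure hs) hw
    · calc (s : G) * (c * w * d) = (s * c * w) * d := by simp only [mul_assoc]
        _ = _ := by rw [hef]; simp only [mul_assoc, Subgroup.coe_mul]
  · obtain ⟨e, he, f, hf, hef⟩ := DoubleCoset.mem_doubleCoset.1 h'
    refine ⟨w, hw, DoubleCoset.mem_doubleCoset.2 ⟨e, he, f * d, P.B.mul_mem hf hd, ?_⟩⟩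
    calc (s : G) * (c * w * d) = (s * c * w) * d := by simp only [mul_assoc]
      _ = _ := by rw [hef]; simp only [mul_assoc]

theorem mul_mem_parabolicSet_of_weyl (J : Set P.S) (w : P.Weyl) (hw : w ∈ P.weylParabolic J) :
    ∀ v : P.N, (v : P.Weyl) = w → ∀ x ∈ P.parabolicSet J, (v : G) * x ∈ P.parabolicSet J := by
  induction hw using Subgroup.closure_induction_left with
  | one =>
    intro v hv x hx
    exact P.mul_mem_parabolicSet_of_B J
      (Subgroup.mem_subgroupOf.1 ((QuotientGroup.eq_one_iff v).1 hv)) hx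
  | mul_left s hs y hy ih =>
    intro v hv x hx
    obtain ⟨t, rfl⟩ := QuotientGroup.mk_surjective s
    have h := ih (t⁻¹ * v) (by rw [QuotientGroup.mk_mul, hv, QuotientGroup.mk_inv]; group) x hx
    have h2 := P.mul_mem_parabolicSet_of_gen J hs h
    simpa [mul_assoc] using h2
  | inv_mul_cancel s hs y hy ih =>
    intro v hv x hx
    have hsS : s ∈ P.S := by
      obtain ⟨t, -, ht⟩ := hs
      rw [← ht]; exact t.2
    have hsq : s⁻¹ = s := by
      have := pow_orderOf_eq_one s
      rw [P.orderOf_S s hsS, pow_two] at this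
      exact inv_eq_of_mul_eq_one_left this
    obtain ⟨t, rfl⟩ := QuotientGroup.mk_surjective s
    rw [hsq] at hv
    have h := ih (t⁻¹ * v) (by rw [QuotientGroup.mk_mul, hv, QuotientGroup.mk_inv]; group) x hx
    have h2 := P.mul_mem_parabolicSet_of_gen J hs h
    simpa [mul_assoc] using h2

/-- The standard parabolic subgroup `G_J = B W_J B`, for `J ⊆ S`. -/
def parabolic (J : Set P.S) : Subgroup G where
  carrier := P.parabolicSet J
  one_mem' := ⟨1, (P.weylParabolic J).one_mem, DoubleCoset.mem_doubleCoset.2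
    ⟨1, P.B.one_mem, 1, P.B.one_mem, by simp⟩⟩
  mul_mem' := by
    rintro x y ⟨w, hw, h⟩ hy
    obtain ⟨c, hc, d, hd, rfl⟩ := DoubleCoset.mem_doubleCoset.1 h
    have := P.mul_mem_parabolicSet_of_B J hc
      (P.mul_mem_parabolicSet_of_weyl J w hw w rfl _ (P.mul_mem_parabolicSet_of_B J hd hy))
    simpa only [mul_assoc] using this
  inv_mem' := by
    rintro x ⟨w, hw, h⟩
    obtain ⟨c, hc, d, hd, rfl⟩ := DoubleCoset.mem_doubleCoset.1 h
    exact ⟨w⁻¹, (P.weylParabolic J).inv_mem hw, DoubleCoset.mem_doubleCoset.2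
      ⟨d⁻¹, P.B.inv_mem hd, c⁻¹, P.B.inv_mem hc, by simp [mul_assoc]⟩⟩

/-- The vertex set of the building: the disjoint union over `s ∈ S` of the coset spaces
`G / G_(s)`, where `(s) = S \ {s}`. -/
abbrev Vertex : Type u := Σ s : P.S, G ⧸ P.parabolic {s}ᶜ

/-- The vertex `g G_(s)`. -/
def vertex (g : G) (s : P.S) : P.Vertex := ⟨s, (g : G ⧸ P.parabolic {s}ᶜ)⟩

/-- The vertices of the chamber `C_g = {g G_(s) : s ∈ S}`. -/
def chamber (g : G) : Set P.Vertex := Set.range (P.vertex g)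

/-- The building `Δ(G; B, N)`: the simplices are the nonempty finite subsets of chambers. -/
def building : PreAbstractSimplicialComplex P.Vertex where
  faces := {σ | σ.Nonempty ∧ ∃ g : G, (σ : Set P.Vertex) ⊆ P.chamber g}
  isRelLowerSet_faces := by
    rintro σ ⟨hσ, g, hg⟩
    exact ⟨hσ, fun τ hτ hne => ⟨hne, g, (Finset.coe_subset.2 hτ).trans hg⟩⟩

end BNPair

namespace PreAbstractSimplicialComplex

variable {V : Type u}

/-- The induced subcomplex `K[U]` on a set `U` of vertices. -/
def induced (K : PreAbstractSimplicialComplex V) (U : Set V) : PreAbstractSimplicialComplex V where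
  faces := {σ | σ ∈ K.faces ∧ (σ : Set V) ⊆ U}
  isRelLowerSet_faces := by
    rintro σ ⟨hσ, hU⟩
    exact ⟨(K.isRelLowerSet_faces hσ).1, fun τ hτ hne =>
      ⟨(K.isRelLowerSet_faces hσ).2 hτ hne, (Finset.coe_subset.2 hτ).trans hU⟩⟩

/-- `K` has dimension `d`: the maximum of `|σ| - 1` over the simplices `σ` of `K` is `d`. -/
def HasDim (K : PreAbstractSimplicialComplex V) (d : ℤ) : Prop :=
  IsGreatest ((fun σ : Finset V => (σ.card : ℤ) - 1) '' K.faces) d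

/-- The `i`-dimensional simplices of `K`, where the empty set is the only simplex of
dimension `-1`. -/
abbrev Simplex (K : PreAbstractSimplicialComplex V) (i : ℤ) : Type u :=
  {σ : Finset V // (σ = ∅ ∨ σ ∈ K.faces) ∧ (σ.card : ℤ) = i + 1}

/-- The augmented simplicial `i`-chains of `K` with coefficients in `𝔽₂`. -/
abbrev Chain (K : PreAbstractSimplicialComplex V) (i : ℤ) : Type u :=
  K.Simplex i →₀ ZMod 2

open Classical in
/-- The facet of a simplex `σ` opposite to a vertex `v` of `σ`. -/
noncomputable def facet (K : PreAbstractSimplicialComplex V) {i j : ℤ} (h : j + 1 = i)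
    (σ : K.Simplex i) (v : σ.1) : K.Simplex j :=
  ⟨σ.1.erase v, by
    constructor
    · rcases σ.2.1 with h0 | h0
      · exact Or.inl (by simp [h0])
      · rcases (σ.1.erase (v : V)).eq_empty_or_nonempty with he | he
        · exact Or.inl he
        · exact Or.inr ((K.isRelLowerSet_faces h0).2 (Finset.erase_subset _ _) he)
    · have h1 := Finset.card_erase_add_one v.2
      have h2 := σ.2.2
      omega⟩

/-- The boundary map `∂ : C_i → C_j` for `i = j + 1`, sending a simplex to the sum of its facets. -/
noncomputable def boundary (K : PreAbstractSimplicialComplex V) (i j : ℤ) (h : j + 1 = i) :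
    K.Chain i →ₗ[ZMod 2] K.Chain j :=
  Finsupp.linearCombination (ZMod 2) fun σ : K.Simplex i =>
    ∑ v : σ.1, Finsupp.single (K.facet h σ v) (1 : ZMod 2)

theorem boundary_boundary (K : PreAbstractSimplicialComplex V) (i j l : ℤ) (h : j + 1 = i)
    (h' : l + 1 = j) (c : K.Chain i) : K.boundary j l h' (K.boundary i j h c) = 0 := by
  classical
  suffices H : (K.boundary j l h').comp (K.boundary i j h) = 0 from LinearMap.congr_fun H c
  refine Finsupp.lhom_ext' fun σ => LinearMap.ext_ring ?_
  simp only [boundary, LinearMap.comp_apply, Finsupp.lsingle_apply,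
    Finsupp.linearCombination_single, one_smul, map_sum, LinearMap.zero_apply]
  rw [Finset.sum_sigma']
  refine Finset.sum_involution
    (fun x _ => ⟨⟨x.2.1, Finset.mem_of_mem_erase x.2.2⟩, ⟨x.1.1, Finset.mem_erase.2
      ⟨fun e => (Finset.mem_erase.1 x.2.2).1 e.symm, x.1.2⟩⟩⟩) ?_ ?_ ?_ ?_
  · rintro ⟨v, w⟩ -
    have e : K.facet h' (K.facet h σ v) w = K.facet h' (K.facet h σ
        ⟨w.1, Finset.mem_of_mem_erase w.2⟩) ⟨v.1, Finset.mem_erase.2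
          ⟨fun e => (Finset.mem_erase.1 w.2).1 e.symm, v.2⟩⟩ := by
      apply Subtype.ext
      simp only [facet]
      exact Finset.erase_right_comm
    rw [← e, ← Finsupp.single_add]
    simp [show (1 : ZMod 2) + 1 = 0 from rfl]
  · rintro ⟨v, w⟩ - - e
    have h1 : w.1 = v.1 := congrArg (fun x => x.1.1) e
    exact (Finset.mem_erase.1 w.2).1 h1
  · intros; exact Finset.mem_univ _
  · rintro ⟨v, w⟩ -
    rfl

/-- The space of (reduced) `i`-cycles. -/
noncomputable def cycles (K : PreAbstractSimplicialComplex V) (i : ℤ) :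
    Submodule (ZMod 2) (K.Chain i) :=
  LinearMap.ker (K.boundary i (i - 1) (by ring))

/-- The space of `i`-boundaries. -/
noncomputable def boundaries (K : PreAbstractSimplicialComplex V) (i : ℤ) :
    Submodule (ZMod 2) (K.Chain i) :=
  LinearMap.range (K.boundary (i + 1) i rfl)

theorem boundaries_le_cycles (K : PreAbstractSimplicialComplex V) (i : ℤ) :
    K.boundaries i ≤ K.cycles i := by
  rintro _ ⟨c, rfl⟩
  exact K.boundary_boundary _ _ _ _ _ c

/-- The `i`-boundaries as a subspace of the `i`-cycles. -/
noncomputable def boundariesInCycles (K : PreAbstractSimplicialComplex V) (i : ℤ) :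
    Submodule (ZMod 2) (K.cycles i) :=
  (K.boundaries i).comap (K.cycles i).subtype

/-- The reduced simplicial homology `H̃_i(K; 𝔽₂)`: cycles modulo boundaries. -/
abbrev ReducedHomology (K : PreAbstractSimplicialComplex V) (i : ℤ) : Type u :=
  K.cycles i ⧸ K.boundariesInCycles i

end PreAbstractSimplicialComplex

namespace BNPair

variable {G : Type u} [Group G] (P : BNPair G)

/-- The vertex set `V_g = {g w G_(s) : w ∈ W, s ∈ S}`. Since `B ∩ N ⊆ G_(s)`, the coset `w G_(s)`
does not depend on the representative of `w` in `N`. -/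
def apartmentVertices (g : G) : Set P.Vertex :=
  {v | ∃ (w : P.N) (s : P.S), v = P.vertex (g * (w : G)) s}

/-- The apartment `A_g`: the subcomplex of the building induced on `V_g`. -/
def apartment (g : G) : PreAbstractSimplicialComplex P.Vertex :=
  P.building.induced (P.apartmentVertices g)

end BNPair

/-! Since `Y` has dimension `n`, all the apartments share a chamber. Based at a suitable
representative `x` of it, they become `A_{x c_j}` with every `c_j` in `B` and one of them equal to
`1`. The chambers of `Y` are then the `x w` with `w⁻¹ c_j w ∈ B` for all `j`, that is, those fixed
by every `x c_j x⁻¹`. Let `D` be the set of these `w`. Ordering `D` by word length, the gallery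
distance from `x`, gives a shelling of `Y`: the new faces of `x w` are those containing all its
vertices of type `s` with `ℓ(ws) < ℓ(w)`. A complex shelled by `n`-simplices has no reduced homology
below degree `n`.

Three facts make this a shelling. Every face of `Y` lies in a chamber of `D`
(`exists_fixed_chamber`), and `D` is closed under passing from `w` to a shorter `ws`; both come from
`conj_mem_of_no_descent`. Moreover `w` is the unique shortest element of `w⟨J⟩` when it has no right
descent in `J` (`length_lt_of_no_descent`). The last rests on the exchange condition, which
`isFolding` extracts from the BN-pair axioms through the Bruhat decomposition. The homology is
handled by `exists_simplexBoundary_eq`: the part of a cycle on new faces is pushed onto old ones by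
coning from a vertex outside the restriction. -/

/-! ### Word length, exchange and minimal coset representatives -/

section WordLength

variable {W : Type*} [Group W]

/-- The minimal length of a word in `S` with product `w`. -/
noncomputable def wordLength (S : Set W) (w : W) : ℕ :=
  sInf {k | ∃ l : List W, (∀ x ∈ l, x ∈ S) ∧ l.prod = w ∧ l.length = k}

theorem wordLength_le {S : Set W} {l : List W} (hl : ∀ x ∈ l, x ∈ S) :
    wordLength S l.prod ≤ l.length :=
  Nat.sInf_le ⟨l, hl, rfl, rfl⟩

theorem exists_word {S : Set W} (hS : ∀ s ∈ S, s * s = 1) {w : W}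
    (hw : w ∈ Subgroup.closure S) :
    ∃ l : List W, (∀ x ∈ l, x ∈ S) ∧ l.prod = w ∧ l.length = wordLength S w := by
  obtain ⟨l, hl, hlw⟩ := Submonoid.exists_list_of_mem_closure
    (Subgroup.closure_toSubmonoid S ▸ hw : w ∈ Submonoid.closure (S ∪ S⁻¹))
  refine Nat.sInf_mem (s := {k | ∃ l : List W, (∀ x ∈ l, x ∈ S) ∧ l.prod = w ∧ l.length = k})
    ⟨l.length, l, fun x hx => ?_, hlw, rfl⟩
  rcases hl x hx with h | h
  · exact h
  · have := eq_inv_of_mul_eq_one_left (hS _ h)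
    rw [inv_inv] at this
    rwa [Set.mem_inv, this] at h

theorem wordLength_one (S : Set W) : wordLength S 1 = 0 :=
  Nat.le_zero.1 (wordLength_le (S := S) (l := []) (by simp))

theorem exists_length_minimal (S J : Set W) (w : W) : ∃ v, v⁻¹ * w ∈ Subgroup.closure J ∧
    ∀ u ∈ Subgroup.closure J, wordLength S v ≤ wordLength S (v * u) := by
  obtain ⟨u, hu⟩ : ∃ u : Subgroup.closure J, ∀ v : Subgroup.closure J,
      wordLength S (w * u) ≤ wordLength S (w * v) :=
    ⟨_, fun v => Function.argmin_le (fun u : Subgroup.closure J => wordLength S (w * u)) v⟩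
  refine ⟨w * u, ?_, fun v hv => ?_⟩
  · simp
  · simpa [mul_assoc] using hu (u * ⟨v, hv⟩)

/-- A generating set of involutions. -/
structure IsInvolutiveGenerating (S : Set W) : Prop where
  closure_eq : Subgroup.closure S = ⊤
  mul_self : ∀ s ∈ S, s * s = 1

/-- A generating set of involutions satisfying the folding condition, equivalent to the exchange
condition that characterises Coxeter groups. -/
structure IsFolding (S : Set W) : Prop extends IsInvolutiveGenerating S where
  ne_one : ∀ s ∈ S, s ≠ 1
  length_ne : ∀ s ∈ S, ∀ w, wordLength S (s * w) ≠ wordLength S w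
  fold : ∀ s ∈ S, ∀ t ∈ S, ∀ w, wordLength S w < wordLength S (s * w) →
    wordLength S (s * (w * t)) < wordLength S (w * t) → s * w = w * t

namespace IsInvolutiveGenerating

variable {S : Set W} (h : IsInvolutiveGenerating S)
include h

theorem exists_word (w : W) :
    ∃ l : List W, (∀ x ∈ l, x ∈ S) ∧ l.prod = w ∧ l.length = wordLength S w :=
  _root_.exists_word h.mul_self (h.closure_eq ▸ Subgroup.mem_top w)

theorem inv_eq {s : W} (hs : s ∈ S) : s⁻¹ = s :=
  inv_eq_of_mul_eq_one_left (h.mul_self s hs)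

theorem length_mul_le {s : W} (hs : s ∈ S) (w : W) :
    wordLength S (s * w) ≤ wordLength S w + 1 := by
  obtain ⟨l, hl, rfl, hlen⟩ := h.exists_word w
  rw [← hlen]
  exact wordLength_le (l := s :: l) (by simpa using ⟨hs, hl⟩)

theorem length_le_mul {s : W} (hs : s ∈ S) (w : W) :
    wordLength S w ≤ wordLength S (s * w) + 1 := by
  have := h.length_mul_le hs (s * w)
  rwa [← mul_assoc, h.mul_self s hs, one_mul] at this

theorem length_inv_le (w : W) : wordLength S w⁻¹ ≤ wordLength S w := by
  obtain ⟨l, hl, rfl, hlen⟩ := h.exists_word w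
  rw [← hlen, List.prod_inv_reverse]
  refine (wordLength_le fun x hx => ?_).trans (by simp)
  simp only [List.mem_reverse, List.mem_map] at hx
  obtain ⟨y, hy, rfl⟩ := hx
  rw [h.inv_eq (hl y hy)]
  exact hl y hy

theorem length_inv (w : W) : wordLength S w⁻¹ = wordLength S w :=
  (h.length_inv_le w).antisymm (by simpa using h.length_inv_le w⁻¹)

theorem length_mul_le' {s : W} (hs : s ∈ S) (w : W) :
    wordLength S (w * s) ≤ wordLength S w + 1 := by
  have := h.length_mul_le hs w⁻¹
  rwa [← h.length_inv, mul_inv_rev, inv_inv, h.inv_eq hs, h.length_inv] at this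

theorem eq_one_of_length {w : W} (hw : wordLength S w = 0) : w = 1 := by
  obtain ⟨l, hl, rfl, hlen⟩ := h.exists_word w
  rw [hw, List.length_eq_zero_iff] at hlen
  simp [hlen]

theorem exists_left {w : W} (hw : w ≠ 1) :
    ∃ s ∈ S, ∃ v, w = s * v ∧ wordLength S w = wordLength S v + 1 := by
  obtain ⟨l, hl, rfl, hlen⟩ := h.exists_word w
  cases l with
  | nil => simp at hw
  | cons s l =>
    simp only [List.mem_cons, forall_eq_or_imp] at hl
    refine ⟨s, hl.1, l.prod, by simp, le_antisymm ?_ ?_⟩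
    · simpa using h.length_mul_le hl.1 l.prod
    · have := wordLength_le hl.2
      simp only [List.length_cons] at hlen
      omega

theorem exists_right {w : W} (hw : w ≠ 1) :
    ∃ s ∈ S, ∃ v, w = v * s ∧ wordLength S w = wordLength S v + 1 := by
  obtain ⟨s, hs, v, hv, hl⟩ := h.exists_left (inv_ne_one.2 hw)
  refine ⟨s, hs, v⁻¹, ?_, by rw [h.length_inv, ← hl, h.length_inv]⟩
  rw [← inv_inv w, hv, mul_inv_rev, h.inv_eq hs]

end IsInvolutiveGenerating

namespace IsFolding

variable {S : Set W} (h : IsFolding S)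
include h

theorem length_ne' {s : W} (hs : s ∈ S) (w : W) : wordLength S (w * s) ≠ wordLength S w := by
  have hI := h.toIsInvolutiveGenerating
  have := h.length_ne s hs w⁻¹
  rwa [← hI.length_inv, mul_inv_rev, inv_inv, hI.inv_eq hs, hI.length_inv] at this

theorem fold' {s t : W} (hs : s ∈ S) (ht : t ∈ S) (w : W)
    (h₁ : wordLength S w < wordLength S (w * t))
    (h₂ : wordLength S (s * w * t) < wordLength S (s * w)) : s * w = w * t := by
  have hI := h.toIsInvolutiveGenerating
  have := h.fold t ht s hs w⁻¹
  rw [hI.length_inv, ← hI.length_inv (t * w⁻¹), ← hI.length_inv (t * (w⁻¹ * s)),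
    ← hI.length_inv (w⁻¹ * s)] at this
  simp only [mul_inv_rev, inv_inv, hI.inv_eq hs, hI.inv_eq ht] at this
  have := congrArg (·⁻¹) (this h₁ h₂)
  simp only [mul_inv_rev, inv_inv, hI.inv_eq hs, hI.inv_eq ht] at this
  exact this.symm

/-- The exchange condition. -/
theorem exchange {s : W} (hs : s ∈ S) : ∀ l : List W, (∀ x ∈ l, x ∈ S) →
    wordLength S (l.prod * s) < wordLength S l.prod →
    ∃ a x b, l = a ++ x :: b ∧ l.prod * s = (a ++ b).prod
  | [], _, hlt => by simp [wordLength_one] at hlt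
  | a :: l, hl, hlt => by
    simp only [List.mem_cons, forall_eq_or_imp] at hl
    rw [List.prod_cons] at hlt
    -- Either `s` already shortens the tail, or it shortens the word only once `a` is prepended;
    -- then folding gives `a * l.prod = l.prod * s`, and the deleted letter is `a`.
    rcases lt_or_gt_of_ne (h.length_ne' hs l.prod) with hlt' | hgt
    · obtain ⟨b, x, c, rfl, e⟩ := exchange hs l hl.2 hlt'
      exact ⟨a :: b, x, c, by simp, by rw [List.prod_cons, mul_assoc, e]; simp⟩
    · have e := h.fold' hl.1 hs l.prod hgt hlt
      refine ⟨[], a, l, rfl, ?_⟩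
      rw [List.prod_cons, e, mul_assoc, h.mul_self s hs]
      simp

/-- If appending a letter `t` shortened the product, exchange would delete a letter. Deleting it
from the word in `J` contradicts reducedness; deleting it from a reduced word of `w` contradicts
minimality of `w` in its coset. -/
theorem length_minimal_mul_prod {J : Set W} (hJ : J ⊆ S) {w : W}
    (hw : ∀ u ∈ Subgroup.closure J, wordLength S w ≤ wordLength S (w * u)) (l : List W)
    (hl : ∀ x ∈ l, x ∈ J) (hlen : wordLength J l.prod = l.length) :
    wordLength S (w * l.prod) = wordLength S w + l.length := by
  have hI := h.toIsInvolutiveGenerating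
  induction l using List.reverseRecOn with
  | nil => simp
  | append_singleton l t ih =>
    simp only [List.mem_append, List.mem_singleton] at hl
    have hl' : ∀ x ∈ l, x ∈ J := fun x hx => hl x (.inl hx)
    have ht : t ∈ J := hl t (.inr rfl)
    have hred : wordLength J l.prod = l.length := by
      refine le_antisymm (wordLength_le hl') ?_
      obtain ⟨m, hm, hmp, hml⟩ := exists_word (S := J) (fun s hs => h.mul_self s (hJ hs))
        (w := l.prod) (Subgroup.list_prod_mem _ fun x hx => Subgroup.subset_closure (hl' x hx))
      have := wordLength_le (S := J) (l := m ++ [t]) (by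
        simp only [List.mem_append, List.mem_singleton]
        rintro x (hx | rfl); exacts [hm x hx, ht])
      simp only [List.prod_append, hmp, List.length_append, hml] at this hlen
      simp only [List.length_singleton] at this hlen
      omega
    have ih := ih hl' hred
    simp only [List.prod_append, List.prod_singleton, List.length_append, List.length_singleton,
      ← mul_assoc] at hlen ⊢
    have hle := hI.length_mul_le' (hJ ht) (w * l.prod)
    rcases lt_or_gt_of_ne (h.length_ne' (hJ ht) (w * l.prod)) with hlt | hgt
    · exfalso
      obtain ⟨l₀, hl₀, rfl, hlen₀⟩ := hI.exists_word w
      rw [← List.prod_append] at hlt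
      obtain ⟨a, x, b, e, hp⟩ := h.exchange (hJ ht) (l₀ ++ l) (by
        simp only [List.mem_append]
        rintro x (hx | hx); exacts [hl₀ x hx, hJ (hl' x hx)]) hlt
      rw [List.append_eq_append_iff] at e
      have hcl : ∀ m : List W, (∀ x ∈ m, x ∈ J) → m.prod ∈ Subgroup.closure J := fun m hm =>
        Subgroup.list_prod_mem _ fun x hx => Subgroup.subset_closure (hm x hx)
      have hdel : ∀ c d : List W, l = c ++ x :: d → (l₀ ++ l).prod * t = l₀.prod * (c ++ d).prod →
          False := by
        rintro c d rfl hp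
        rw [List.prod_append, mul_assoc, mul_right_inj] at hp
        rw [hp] at hlen
        have := wordLength_le (S := J) (l := c ++ d) (fun y hy => hl' y (by
          simp only [List.mem_append, List.mem_cons] at hy ⊢; tauto))
        simp only [List.length_append, List.length_cons] at hlen this
        omega
      rcases e with ⟨c, rfl, hc⟩ | ⟨c, hc₀, hc⟩
      · exact hdel c b hc (by rw [hp]; simp)
      · cases c with
        | nil =>
          simp only [List.append_nil] at hc₀
          subst hc₀
          exact hdel [] b (by simpa using hc.symm) (by rw [hp]; simp)
        | cons y c =>
          simp only [List.cons_append, List.cons.injEq] at hc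
          obtain ⟨rfl, rfl⟩ := hc
          subst hc₀
          -- The deletion happens inside `w`, so `w` times this conjugate of `t`, an element of the
          -- same coset, has a shorter word.
          have h₁ := hw (l.prod * t * (l.prod)⁻¹) ((Subgroup.closure J).mul_mem
            ((Subgroup.closure J).mul_mem (hcl l hl') (Subgroup.subset_closure ht))
            ((Subgroup.closure J).inv_mem (hcl l hl')))
          have h₂ : (a ++ x :: c).prod * (l.prod * t * (l.prod)⁻¹) = (a ++ c).prod := by
            rw [List.prod_append, mul_assoc] at hp
            rw [← mul_assoc, hp]
            simp [mul_assoc]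
          rw [h₂] at h₁
          have := wordLength_le (S := S) (l := a ++ c) (fun y hy => hl₀ y (by
            simp only [List.mem_append, List.mem_cons] at hy ⊢; tauto))
          simp only [List.length_append, List.length_cons] at hlen₀ this
          omega
    · omega

theorem length_minimal_mul {J : Set W} (hJ : J ⊆ S) {w : W}
    (hw : ∀ u ∈ Subgroup.closure J, wordLength S w ≤ wordLength S (w * u)) {u : W}
    (hu : u ∈ Subgroup.closure J) :
    wordLength S (w * u) = wordLength S w + wordLength J u := by
  obtain ⟨l, hl, rfl, hlen⟩ := exists_word (fun s hs => h.mul_self s (hJ hs)) hu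
  rw [h.length_minimal_mul_prod hJ hw l hl hlen.symm, hlen]

/-- Write `w` as the shortest element `v` of its coset times a reduced word in `J`. Lengths add, so
the last letter of a nonempty word would be a right descent of `w` in `J`. -/
theorem length_minimal_of_no_descent {J : Set W} (hJ : J ⊆ S) {w : W}
    (hw : ∀ s ∈ J, wordLength S w < wordLength S (w * s)) :
    ∀ u ∈ Subgroup.closure J, wordLength S w ≤ wordLength S (w * u) := by
  obtain ⟨v, hv, hmin⟩ := exists_length_minimal S J w
  suffices e : v⁻¹ * w = 1 by
    rw [inv_mul_eq_one] at e
    exact e ▸ hmin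
  obtain ⟨l, hl, hp, hlen⟩ := exists_word (fun s hs => h.mul_self s (hJ hs)) hv
  induction l using List.reverseRecOn with
  | nil => simpa using hp.symm
  | append_singleton l t _ =>
    exfalso
    have hlen' : wordLength J (l ++ [t]).prod = (l ++ [t]).length := by rw [hlen, hp]
    have h₁ := h.length_minimal_mul_prod hJ hmin _ hl hlen'
    simp only [List.mem_append, List.mem_singleton] at hl
    have hlJ : ∀ x ∈ l, x ∈ J := fun x hx => hl x (.inl hx)
    have ht : t ∈ J := hl t (.inr rfl)
    have h₂ := h.length_minimal_mul hJ hmin (u := l.prod)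
      (Subgroup.list_prod_mem _ fun x hx => Subgroup.subset_closure (hlJ x hx))
    have h₃ := wordLength_le hlJ
    have e : w * t = v * l.prod := by
      rw [eq_inv_mul_iff_mul_eq] at hp
      rw [← hp, List.prod_append, List.prod_singleton, mul_assoc, mul_assoc,
        h.mul_self t (hJ ht), mul_one]
    have h₄ := hw t ht
    rw [e, h₂] at h₄
    rw [hp, mul_inv_cancel_left] at h₁
    simp only [List.length_append, List.length_singleton] at h₁
    omega

theorem length_lt_of_no_descent {J : Set W} (hJ : J ⊆ S) {w u : W}
    (hw : ∀ s ∈ J, wordLength S w < wordLength S (w * s)) (hu : u ∈ Subgroup.closure J)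
    (hne : u ≠ 1) : wordLength S w < wordLength S (w * u) := by
  rw [h.length_minimal_mul hJ (h.length_minimal_of_no_descent hJ hw) hu, Nat.lt_add_right_iff_pos,
    Nat.pos_iff_ne_zero]
  intro h0
  obtain ⟨l, -, rfl, hlen⟩ := exists_word (fun s hs => h.mul_self s (hJ hs)) hu
  rw [h0, List.length_eq_zero_iff] at hlen
  simp [hlen] at hne

theorem length_eq_of_mem_closure {J : Set W} (hJ : J ⊆ S) {u : W}
    (hu : u ∈ Subgroup.closure J) : wordLength S u = wordLength J u := by
  simpa [wordLength_one] using h.length_minimal_mul hJ (w := 1) (by simp [wordLength_one]) hu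

theorem length_gen {s : W} (hs : s ∈ S) : wordLength S s = 1 := by
  have h₁ := wordLength_le (S := S) (l := [s]) (by simpa using hs)
  simp only [List.prod_singleton, List.length_singleton] at h₁
  have h₂ : wordLength S s ≠ 0 := fun e => h.ne_one s hs (h.eq_one_of_length e)
  omega

theorem mem_of_mem_closure {J : Set W} (hJ : J ⊆ S) {s : W} (hs : s ∈ S)
    (hsJ : s ∈ Subgroup.closure J) : s ∈ J := by
  obtain ⟨l, hl, hp, hlen⟩ := exists_word (fun s hs => h.mul_self s (hJ hs)) hsJ
  rw [← h.length_eq_of_mem_closure hJ hsJ, h.length_gen hs, List.length_eq_one_iff] at hlen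
  obtain ⟨t, rfl⟩ := hlen
  simp only [List.mem_singleton, forall_eq, List.prod_singleton] at hl hp
  exact hp ▸ hl

/-- By exchange, `u * s` is a word of `u` with one letter deleted. It therefore stays in `⟨J⟩`, and
so does `s`. -/
theorem descent_mem {J : Set W} (hJ : J ⊆ S) {s u : W} (hs : s ∈ S)
    (hu : u ∈ Subgroup.closure J) (hlt : wordLength S (u * s) < wordLength S u) : s ∈ J := by
  obtain ⟨l, hl, rfl, -⟩ := exists_word (fun s hs => h.mul_self s (hJ hs)) hu
  obtain ⟨a, x, b, rfl, hp⟩ := h.exchange hs l (fun x hx => hJ (hl x hx)) hlt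
  refine h.mem_of_mem_closure hJ hs ?_
  rw [← (Subgroup.closure J).mul_mem_cancel_left hu, hp]
  refine Subgroup.list_prod_mem _ fun y hy => Subgroup.subset_closure (hl y ?_)
  simp only [List.mem_append, List.mem_cons] at hy ⊢
  tauto

/-- The intersection of standard parabolic subgroups is the standard parabolic subgroup of the
intersection. -/
theorem mem_closure_iInter {ι : Type*} {I : ι → Set W} (hI : ∀ i, I i ⊆ S) {u : W}
    (hu : ∀ i, u ∈ Subgroup.closure (I i)) :
    u ∈ Subgroup.closure {s ∈ S | ∀ i, s ∈ I i} := by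
  induction hn : wordLength S u generalizing u with
  | zero => rw [h.eq_one_of_length hn]; exact one_mem _
  | succ n ih =>
    have hne : u ≠ 1 := by rintro rfl; simp [wordLength_one] at hn
    obtain ⟨s, hs, v, rfl, hl⟩ := h.exists_right hne
    have e : v * s * s = v := by rw [mul_assoc, h.mul_self s hs, mul_one]
    -- A right descent of `u` lies in every `I i`, so it can be stripped off and induction applies.
    have hsI : ∀ i, s ∈ I i := fun i => h.descent_mem (hI i) hs (hu i) (by rw [e]; omega)
    refine mul_mem (ih (fun i => ?_) (by omega)) (Subgroup.subset_closure ⟨hs, hsI⟩)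
    exact ((Subgroup.closure (I i)).mul_mem_cancel_right (Subgroup.subset_closure (hsI i))).1 (hu i)

end IsFolding

end WordLength

/-! ### Bruhat decomposition and the exchange condition for the Weyl group -/

namespace BNPair

variable {G : Type u} [Group G] (P : BNPair G)

/-- The Bruhat cell `B w B`. -/
def cell (w : P.Weyl) : Set G :=
  {g | ∃ n : P.N, (n : P.Weyl) = w ∧
    g ∈ DoubleCoset.doubleCoset (n : G) (P.B : Set G) (P.B : Set G)}

theorem mem_parabolic_iff {J : Set P.S} {g : G} :
    g ∈ P.parabolic J ↔ ∃ w ∈ P.weylParabolic J, g ∈ P.cell w := by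
  constructor
  · rintro ⟨n, hn, h⟩
    exact ⟨n, hn, n, rfl, h⟩
  · rintro ⟨w, hw, n, rfl, h⟩
    exact ⟨n, hw, h⟩

theorem mem_cell_iff {w : P.Weyl} {g : G} :
    g ∈ P.cell w ↔ ∃ n : P.N, (n : P.Weyl) = w ∧ ∃ b ∈ P.B, ∃ c ∈ P.B, g = b * n * c := by
  simp only [cell, Set.mem_ofPred_eq, DoubleCoset.mem_doubleCoset, SetLike.mem_coe]

theorem coe_mem_cell (n : P.N) : (n : G) ∈ P.cell (n : P.Weyl) :=
  P.mem_cell_iff.2 ⟨n, rfl, 1, one_mem _, 1, one_mem _, by simp⟩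

theorem mul_mem_cell {b c g : G} {w : P.Weyl} (hb : b ∈ P.B) (hg : g ∈ P.cell w) (hc : c ∈ P.B) :
    b * g * c ∈ P.cell w := by
  obtain ⟨n, hn, b', hb', c', hc', rfl⟩ := P.mem_cell_iff.1 hg
  exact P.mem_cell_iff.2 ⟨n, hn, b * b', P.B.mul_mem hb hb', c' * c, P.B.mul_mem hc' hc,
    by simp only [mul_assoc]⟩

theorem left_mul_mem_cell {b g : G} {w : P.Weyl} (hb : b ∈ P.B) (hg : g ∈ P.cell w) :
    b * g ∈ P.cell w := by
  simpa using P.mul_mem_cell hb hg (one_mem _)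

theorem right_mul_mem_cell {c g : G} {w : P.Weyl} (hg : g ∈ P.cell w) (hc : c ∈ P.B) :
    g * c ∈ P.cell w := by
  simpa using P.mul_mem_cell (one_mem _) hg hc

theorem inv_mem_cell {g : G} {w : P.Weyl} (hg : g ∈ P.cell w) : g⁻¹ ∈ P.cell w⁻¹ := by
  obtain ⟨n, rfl, b, hb, c, hc, rfl⟩ := P.mem_cell_iff.1 hg
  exact P.mem_cell_iff.2 ⟨n⁻¹, rfl, c⁻¹, inv_mem hc, b⁻¹, inv_mem hb, by simp [mul_assoc]⟩

theorem coe_eq_one_iff {n : P.N} : (n : P.Weyl) = 1 ↔ (n : G) ∈ P.B := by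
  rw [QuotientGroup.eq_one_iff, Subgroup.mem_subgroupOf]

theorem mem_cell_one_iff {g : G} : g ∈ P.cell 1 ↔ g ∈ P.B := by
  constructor
  · rw [mem_cell_iff]
    rintro ⟨n, hn, b, hb, c, hc, rfl⟩
    exact P.B.mul_mem (P.B.mul_mem hb (P.coe_eq_one_iff.1 hn)) hc
  · intro hg
    simpa using P.left_mul_mem_cell hg (P.coe_mem_cell 1)

theorem eq_one_of_mem_cell {g : G} {w : P.Weyl} (hg : g ∈ P.cell w) (hB : g ∈ P.B) : w = 1 := by
  obtain ⟨n, rfl, b, hb, c, hc, rfl⟩ := P.mem_cell_iff.1 hg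
  rwa [P.B.mul_mem_cancel_right hc, P.B.mul_mem_cancel_left hb, ← coe_eq_one_iff] at hB

theorem cell_nonempty (w : P.Weyl) : (P.cell w).Nonempty := by
  obtain ⟨n, rfl⟩ := QuotientGroup.mk_surjective w
  exact ⟨n, P.coe_mem_cell n⟩

theorem isInvolutiveGenerating : IsInvolutiveGenerating P.S where
  closure_eq := P.closure_S
  mul_self s hs := by
    have := pow_orderOf_eq_one s
    rwa [P.orderOf_S s hs, pow_two] at this

theorem gen_ne_one {s : P.Weyl} (hs : s ∈ P.S) : s ≠ 1 := by
  rintro rfl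
  simpa using P.orderOf_S 1 hs

theorem mul_mem_cell_or {s w : P.Weyl} (hs : s ∈ P.S) {x g : G} (hx : x ∈ P.cell s)
    (hg : g ∈ P.cell w) : x * g ∈ P.cell (s * w) ∨ x * g ∈ P.cell w := by
  obtain ⟨n, rfl, b, hb, c, hc, rfl⟩ := P.mem_cell_iff.1 hx
  obtain ⟨m, rfl, d, hd, e, he, rfl⟩ := P.mem_cell_iff.1 hg
  have key : b * n * c * (d * m * e) = b * (n * (c * d) * m) * e := by simp only [mul_assoc]
  rw [key]
  rcases P.mul_mem n m hs (c * d) (P.B.mul_mem hc hd) with h | h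
  · exact .inl (P.mul_mem_cell hb ⟨n * m, rfl, h⟩ he)
  · exact .inr (P.mul_mem_cell hb ⟨m, rfl, h⟩ he)

theorem inv_mem_cell_gen {s : P.Weyl} (hs : s ∈ P.S) {x : G} (hx : x ∈ P.cell s) :
    x⁻¹ ∈ P.cell s := by
  simpa [P.isInvolutiveGenerating.inv_eq hs] using P.inv_mem_cell hx

theorem mul_mem_cell_or' {s w : P.Weyl} (hs : s ∈ P.S) {x g : G} (hx : x ∈ P.cell s)
    (hg : g ∈ P.cell w) : g * x ∈ P.cell (w * s) ∨ g * x ∈ P.cell w := by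
  have h := P.mul_mem_cell_or hs (P.inv_mem_cell_gen hs hx) (P.inv_mem_cell hg)
  rw [← mul_inv_rev] at h
  refine h.imp (fun h => ?_) (fun h => by simpa using P.inv_mem_cell h)
  simpa [P.isInvolutiveGenerating.inv_eq hs] using P.inv_mem_cell h

theorem exists_mul_eq {v u : P.Weyl} {g : G} (hg : g ∈ P.cell (v * u)) :
    ∃ x ∈ P.cell v, ∃ y ∈ P.cell u, x * y = g := by
  obtain ⟨m, rfl⟩ := QuotientGroup.mk_surjective u
  obtain ⟨n, hn, b, hb, c, hc, rfl⟩ := P.mem_cell_iff.1 hg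
  refine ⟨b * (n * m⁻¹ : P.N), P.left_mul_mem_cell hb ?_, m * c,
    P.right_mul_mem_cell (P.coe_mem_cell m) hc, by simp [mul_assoc]⟩
  have := P.coe_mem_cell (n * m⁻¹)
  rwa [QuotientGroup.mk_mul, hn, QuotientGroup.mk_inv, mul_inv_cancel_right] at this

/-- The axiom `s B s⁻¹ ⊄ B` in terms of cells: `BsB · BsB` is not just `B`, so it meets `BsB`. -/
theorem exists_gen_mul {s : P.Weyl} (hs : s ∈ P.S) :
    ∃ x ∈ P.cell s, ∃ y ∈ P.cell s, x * y ∈ P.cell s := by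
  obtain ⟨n, rfl⟩ := QuotientGroup.mk_surjective s
  obtain ⟨b, hb, h⟩ := P.not_le n hs
  have h₁ := P.right_mul_mem_cell (P.coe_mem_cell n) hb
  have h₂ := P.inv_mem_cell_gen hs (P.coe_mem_cell n)
  refine ⟨_, h₁, _, h₂, (P.mul_mem_cell_or hs h₁ h₂).resolve_left fun h₃ => ?_⟩
  rw [P.isInvolutiveGenerating.mul_self _ hs, mem_cell_one_iff] at h₃
  exact h h₃

theorem exists_mem_cell (g : G) : ∃ w, g ∈ P.cell w := by
  have htop : P.parabolic Set.univ = ⊤ := by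
    rw [eq_top_iff, ← P.sup_eq_top, sup_le_iff]
    have hW : P.weylParabolic Set.univ = ⊤ := by
      rw [weylParabolic, Set.image_univ, Subtype.range_coe, P.closure_S]
    refine ⟨fun b hb => P.mem_parabolic_iff.2 ⟨1, one_mem _, P.mem_cell_one_iff.2 hb⟩,
      fun n hn => P.mem_parabolic_iff.2 ⟨((⟨n, hn⟩ : P.N) : P.Weyl), hW ▸ Subgroup.mem_top _,
        P.coe_mem_cell ⟨n, hn⟩⟩⟩
  obtain ⟨w, -, h⟩ := P.mem_parabolic_iff.1 (htop ▸ Subgroup.mem_top g : g ∈ P.parabolic Set.univ)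
  exact ⟨w, h⟩

/-- Induction on the length of `w = s v`: cancelling a factor in `BsB` puts an element of `BvB` in
`B s w' B` or in `B w' B`. The second would give `v = w'`, which is too short. -/
theorem cell_unique_of_length_le {w w' : P.Weyl} (hl : wordLength P.S w ≤ wordLength P.S w')
    {g : G} (hg : g ∈ P.cell w) (hg' : g ∈ P.cell w') : w = w' := by
  have hI := P.isInvolutiveGenerating
  induction hn : wordLength P.S w generalizing w w' g with
  | zero =>
    rw [hI.eq_one_of_length hn] at hg ⊢
    exact (P.eq_one_of_mem_cell hg' (P.mem_cell_one_iff.1 hg)).symm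
  | succ n ih =>
    have hne : w ≠ 1 := by rintro rfl; simp [wordLength_one] at hn
    obtain ⟨s, hs, v, rfl, hv⟩ := hI.exists_left hne
    obtain ⟨x, hx, y, hy, rfl⟩ := P.exists_mul_eq hg
    have hle := hI.length_le_mul hs w'
    rcases P.mul_mem_cell_or hs (P.inv_mem_cell_gen hs hx) hg' with h | h <;>
      rw [inv_mul_cancel_left] at h
    · rw [ih (by omega) hy h (by omega), ← mul_assoc, hI.mul_self s hs, one_mul]
    · have := ih (by omega) hy h (by omega)
      subst this
      omega

theorem cell_unique {w w' : P.Weyl} {g : G} (hg : g ∈ P.cell w) (hg' : g ∈ P.cell w') : w = w' := by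
  rcases le_total (wordLength P.S w) (wordLength P.S w') with h | h
  · exact P.cell_unique_of_length_le h hg hg'
  · exact (P.cell_unique_of_length_le h hg' hg).symm

/-- The inequality is weak on purpose: the case of equality is what later shows that `ℓ(sw) = ℓ(w)`
never occurs. With `w = v t`, the unwanted alternative `x * g ∈ BwB` forces `s v = v` or `s v = v
t`. The first gives `s = 1` and the second `s w = v`, shorter than `w`. -/
theorem mul_mem_cell_of_length_le {s w : P.Weyl} (hs : s ∈ P.S)
    (hl : wordLength P.S w ≤ wordLength P.S (s * w)) {x g : G} (hx : x ∈ P.cell s)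
    (hg : g ∈ P.cell w) : x * g ∈ P.cell (s * w) := by
  have hI := P.isInvolutiveGenerating
  induction hn : wordLength P.S w generalizing w g with
  | zero =>
    rw [hI.eq_one_of_length hn] at hg ⊢
    rw [mul_one]
    exact P.right_mul_mem_cell hx (P.mem_cell_one_iff.1 hg)
  | succ n ih =>
    have hne : w ≠ 1 := by rintro rfl; simp [wordLength_one] at hn
    obtain ⟨t, ht, v, rfl, hv⟩ := hI.exists_right hne
    refine (P.mul_mem_cell_or hs hx hg).elim id fun h => ?_
    exfalso
    obtain ⟨y, hy, z, hz, rfl⟩ := P.exists_mul_eq hg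
    have hle := hI.length_mul_le' ht (s * v)
    rw [mul_assoc] at hle
    have hxy := ih (by omega) hy (by omega)
    have hvt : v * t * t = v := by rw [mul_assoc, hI.mul_self t ht, mul_one]
    have hstv : s * v = v ∨ s * v = v * t := by
      have h' := P.mul_mem_cell_or' ht (P.inv_mem_cell_gen ht hz) h
      rw [hvt, mul_assoc, mul_inv_cancel_right] at h'
      exact h'.imp (P.cell_unique hxy) (P.cell_unique hxy)
    rcases hstv with e | e
    · exact P.gen_ne_one hs (by simpa using e)
    · rw [← mul_assoc, e, hvt] at hl
      omega

theorem mul_mem_cell_of_length_le' {s w : P.Weyl} (hs : s ∈ P.S)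
    (hl : wordLength P.S w ≤ wordLength P.S (w * s)) {x g : G} (hx : x ∈ P.cell s)
    (hg : g ∈ P.cell w) : g * x ∈ P.cell (w * s) := by
  have hI := P.isInvolutiveGenerating
  rw [← hI.length_inv, ← hI.length_inv (w * s), mul_inv_rev, hI.inv_eq hs] at hl
  simpa [hI.inv_eq hs] using P.inv_mem_cell
    (P.mul_mem_cell_of_length_le hs hl (P.inv_mem_cell_gen hs hx) (P.inv_mem_cell hg))

theorem exists_mul_mem_cell {s w : P.Weyl} (hs : s ∈ P.S)
    (hl : wordLength P.S (s * w) < wordLength P.S w) :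
    ∃ x ∈ P.cell s, ∃ g ∈ P.cell w, x * g ∈ P.cell w := by
  obtain ⟨x, hx, y, hy, hxy⟩ := P.exists_gen_mul hs
  obtain ⟨z, hz⟩ := P.cell_nonempty (s * w)
  have e : s * (s * w) = w := by
    rw [← mul_assoc, P.isInvolutiveGenerating.mul_self s hs, one_mul]
  have h₁ := P.mul_mem_cell_of_length_le hs (by rw [e]; exact hl.le) hy hz
  have h₂ := P.mul_mem_cell_of_length_le hs (by rw [e]; exact hl.le) hxy hz
  rw [e] at h₁ h₂
  exact ⟨x, hx, y * z, h₁, by rwa [← mul_assoc]⟩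

/-- The Weyl group of a BN-pair satisfies the folding condition. -/
theorem isFolding : IsFolding P.S where
  toIsInvolutiveGenerating := P.isInvolutiveGenerating
  ne_one _ := P.gen_ne_one
  -- With equal lengths, products by `BsB` land in a single cell in both directions. Choosing `x`,
  -- `y` and `x * y` all in `BsB` then puts `x * y * z` in the cells of both `s * w` and `w`.
  length_ne s hs w hl := by
    obtain ⟨x, hx, y, hy, hxy⟩ := P.exists_gen_mul hs
    obtain ⟨z, hz⟩ := P.cell_nonempty w
    have e : s * (s * w) = w := by
      rw [← mul_assoc, P.isInvolutiveGenerating.mul_self s hs, one_mul]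
    have h₁ := P.mul_mem_cell_of_length_le hs hl.ge hy hz
    have h₂ := P.mul_mem_cell_of_length_le hs (by rw [e, hl]) hx h₁
    have h₃ := P.mul_mem_cell_of_length_le hs hl.ge hxy hz
    rw [e, ← mul_assoc] at h₂
    exact P.gen_ne_one hs (by simpa using P.cell_unique h₃ h₂)
  -- For `y` in `BwB` and `z` in `BtB` with `y * z` and `x * y * z` in `BwtB`, the element `x * y`
  -- lies in `BswB`. Cancelling `z` puts it in `BwB` or `BwtB`, and the former would give `s = 1`.
  fold s hs t ht w h₁ h₂ := by
    have hI := P.isInvolutiveGenerating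
    obtain ⟨x, hx, g, hg, hxg⟩ := P.exists_mul_mem_cell hs h₂
    obtain ⟨y, hy, z, hz, rfl⟩ := P.exists_mul_eq hg
    have hxy := P.mul_mem_cell_of_length_le hs h₁.le hx hy
    have h' := P.mul_mem_cell_or' ht (P.inv_mem_cell_gen ht hz) hxg
    rw [mul_assoc w, hI.mul_self t ht, mul_one, mul_assoc, mul_inv_cancel_right] at h'
    rcases h' with h' | h'
    · exact absurd (by simpa using P.cell_unique hxy h') (P.gen_ne_one hs)
    · exact P.cell_unique hxy h'

end BNPair

/-! ### Mod 2 chains on finite sets and homology of shellings -/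

section Shelling

variable {V : Type*} [DecidableEq V]

/-- The mod 2 simplicial boundary, sending a finite set to the sum of its facets. -/
noncomputable def simplexBoundary : (Finset V →₀ ZMod 2) →ₗ[ZMod 2] (Finset V →₀ ZMod 2) :=
  Finsupp.linearCombination (ZMod 2) fun σ => ∑ v ∈ σ, Finsupp.single (σ.erase v) 1

/-- The cone operator with apex `v`. -/
noncomputable def simplexCone (v : V) : (Finset V →₀ ZMod 2) →ₗ[ZMod 2] (Finset V →₀ ZMod 2) :=
  Finsupp.linearCombination (ZMod 2) fun σ =>
    if v ∈ σ then 0 else Finsupp.single (insert v σ) 1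

theorem simplexBoundary_single (σ : Finset V) :
    simplexBoundary (Finsupp.single σ 1) = ∑ v ∈ σ, Finsupp.single (σ.erase v) (1 : ZMod 2) := by
  simp [simplexBoundary]

theorem simplexCone_single (v : V) (σ : Finset V) :
    simplexCone v (Finsupp.single σ 1) =
      if v ∈ σ then 0 else Finsupp.single (insert v σ) (1 : ZMod 2) := by
  simp [simplexCone]

theorem chain_add_self {α : Type*} (c : α →₀ ZMod 2) : c + c = 0 := by
  ext a
  exact CharTwo.add_self_eq_zero (c a)

/-- The cone operator is a contracting homotopy. No augmentation term appears because `∅` counts as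
a simplex. -/
theorem simplexBoundary_cone_add (v : V) (c : Finset V →₀ ZMod 2) :
    simplexBoundary (simplexCone v c) + simplexCone v (simplexBoundary c) = c := by
  suffices H : simplexBoundary ∘ₗ simplexCone v + simplexCone v ∘ₗ simplexBoundary =
      LinearMap.id from LinearMap.congr_fun H c
  refine Finsupp.lhom_ext' fun σ => LinearMap.ext_ring ?_
  simp only [LinearMap.add_apply, LinearMap.comp_apply, Finsupp.lsingle_apply, LinearMap.id_apply,
    simplexBoundary_single, simplexCone_single, map_sum]
  by_cases hv : v ∈ σ
  · rw [if_pos hv, map_zero, zero_add, Finset.sum_eq_single_of_mem v hv]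
    · simp [Finset.insert_erase hv]
    · intro u _ hu
      rw [if_pos (Finset.mem_erase.2 ⟨hu.symm, hv⟩)]
  · rw [if_neg hv, simplexBoundary_single, Finset.sum_insert hv, Finset.erase_insert hv, add_assoc,
      ← Finset.sum_add_distrib, Finset.sum_eq_zero, add_zero]
    intro u hu
    have hvu : v ≠ u := by rintro rfl; exact hv hu
    rw [if_neg (fun h => hv (Finset.mem_of_mem_erase h)), Finset.erase_insert_of_ne hvu,
      chain_add_self]

theorem simplexBoundary_boundary (c : Finset V →₀ ZMod 2) :
    simplexBoundary (simplexBoundary c) = 0 := by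
  suffices H : simplexBoundary ∘ₗ simplexBoundary = (0 : (Finset V →₀ ZMod 2) →ₗ[ZMod 2] _) from
    LinearMap.congr_fun H c
  refine Finsupp.lhom_ext' fun σ => LinearMap.ext_ring ?_
  simp only [LinearMap.comp_apply, Finsupp.lsingle_apply, LinearMap.zero_apply]
  induction σ using Finset.induction_on with
  | empty => simp [simplexBoundary_single]
  | insert v σ hv ih =>
    have e : Finsupp.single (insert v σ) (1 : ZMod 2) = simplexCone v (Finsupp.single σ 1) := by
      rw [simplexCone_single, if_neg hv]
    have h₁ := eq_sub_of_add_eq (simplexBoundary_cone_add v (Finsupp.single σ 1))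
    have h₂ := simplexBoundary_cone_add v (simplexBoundary (Finsupp.single σ 1))
    rw [ih, map_zero, add_zero] at h₂
    rw [e, h₁, map_sub, h₂, sub_self]

theorem linearCombination_mem_of_supported {α M : Type*} [AddCommGroup M] [Module (ZMod 2) M]
    {f : α → M} {A : Set α} {p : Submodule (ZMod 2) M} (hf : ∀ a ∈ A, f a ∈ p) {z : α →₀ ZMod 2}
    (hz : z ∈ Finsupp.supported (ZMod 2) (ZMod 2) A) :
    Finsupp.linearCombination (ZMod 2) f z ∈ p := by
  rw [Finsupp.linearCombination_apply]
  exact Submodule.sum_mem _ fun a ha => p.smul_mem _ (hf a (hz ha))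

theorem simplexBoundary_mem_supported {A A' : Set (Finset V)}
    (h : ∀ σ ∈ A, ∀ v ∈ σ, σ.erase v ∈ A') {z : Finset V →₀ ZMod 2}
    (hz : z ∈ Finsupp.supported (ZMod 2) (ZMod 2) A) :
    simplexBoundary z ∈ Finsupp.supported (ZMod 2) (ZMod 2) A' :=
  linearCombination_mem_of_supported (fun σ hσ => Submodule.sum_mem _ fun v hv =>
    Finsupp.single_mem_supported _ _ (h σ hσ v hv)) hz

theorem simplexCone_mem_supported {A A' : Set (Finset V)} {v : V}
    (h : ∀ σ ∈ A, v ∉ σ → insert v σ ∈ A') {z : Finset V →₀ ZMod 2}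
    (hz : z ∈ Finsupp.supported (ZMod 2) (ZMod 2) A) :
    simplexCone v z ∈ Finsupp.supported (ZMod 2) (ZMod 2) A' := by
  refine linearCombination_mem_of_supported (fun σ hσ => ?_) hz
  split_ifs with hv
  · exact zero_mem _
  · exact Finsupp.single_mem_supported _ _ (h σ hσ hv)

/-- If the simplices `C i`, ordered by `ℓ`, form a shelling with restrictions `R i`, then cycles
below the top dimension are boundaries. -/
theorem exists_simplexBoundary_eq {ι : Type*} [DecidableEq ι] {C R : ι → Finset V} {ℓ : ι → ℕ}
    {n : ℕ} (hC : ∀ i, (C i).card = n + 1) {D : Finset ι}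
    (hold : ∀ i ∈ D, ∀ σ ⊆ C i, ¬ R i ⊆ σ → ∃ j ∈ D, ℓ j < ℓ i ∧ σ ⊆ C j)
    (hnew : ∀ i ∈ D, ∀ j ∈ D, j ≠ i → ℓ j ≤ ℓ i → ∀ σ ⊆ C i, σ ⊆ C j → ¬ R i ⊆ σ)
    {m : ℕ} (hm : m ≤ n) {z : Finset V →₀ ZMod 2}
    (hz : z ∈ Finsupp.supported (ZMod 2) (ZMod 2) {σ | σ.card = m ∧ ∃ i ∈ D, σ ⊆ C i})
    (hz0 : simplexBoundary z = 0) :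
    ∃ y ∈ Finsupp.supported (ZMod 2) (ZMod 2) {σ | σ.card = m + 1 ∧ ∃ i ∈ D, σ ⊆ C i},
      simplexBoundary y = z := by
  classical
  induction D using Finset.induction_on_max_value ℓ generalizing z with
  | empty =>
    have : z = 0 := by simpa using hz
    exact ⟨0, zero_mem _, by simp [this]⟩
  | insert a D ha hmax ih =>
    have hold' : ∀ i ∈ D, ∀ σ ⊆ C i, ¬ R i ⊆ σ → ∃ j ∈ D, ℓ j < ℓ i ∧ σ ⊆ C j := by
      intro i hi σ hσ hR
      obtain ⟨j, hj, hlt, hσj⟩ := hold i (Finset.mem_insert_of_mem hi) σ hσ hR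
      rcases Finset.mem_insert.1 hj with rfl | hj
      · exact absurd (hmax i hi) hlt.not_ge
      · exact ⟨j, hj, hlt, hσj⟩
    have holda : ∀ σ ⊆ C a, ¬ R a ⊆ σ → ∃ j ∈ D, σ ⊆ C j := by
      intro σ hσ hR
      obtain ⟨j, hj, hlt, hσj⟩ := hold a (Finset.mem_insert_self _ _) σ hσ hR
      rcases Finset.mem_insert.1 hj with rfl | hj
      · exact absurd hlt (lt_irrefl _)
      · exact ⟨j, hj, hσj⟩
    have hnewa : ∀ σ ⊆ C a, ∀ j ∈ D, σ ⊆ C j → ¬ R a ⊆ σ := fun σ hσ j hj hσj =>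
      hnew a (Finset.mem_insert_self _ _) j (Finset.mem_insert_of_mem hj)
        (by rintro rfl; exact ha hj) (hmax j hj) σ hσ hσj
    have ih := @ih hold' fun i hi j hj => hnew i (Finset.mem_insert_of_mem hi) j
      (Finset.mem_insert_of_mem hj)
    have hmono : ∀ k, Finsupp.supported (ZMod 2) (ZMod 2) {σ | σ.card = k ∧ ∃ i ∈ D, σ ⊆ C i} ≤
        Finsupp.supported (ZMod 2) (ZMod 2) {σ | σ.card = k ∧ ∃ i ∈ insert a D, σ ⊆ C i} :=
      fun k => Finsupp.supported_mono fun σ ⟨h, i, hi, hσ⟩ =>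
        ⟨h, i, Finset.mem_insert_of_mem hi, hσ⟩
    -- Split `z` into its part on the faces that the last chamber `C a` adds and its part on the
    -- older faces.
    set z₁ := z.filter (fun σ => R a ⊆ σ ∧ σ ⊆ C a) with hz₁
    set z₂ := z.filter (fun σ => ¬ (R a ⊆ σ ∧ σ ⊆ C a)) with hz₂
    have hz₁₂ : z₁ + z₂ = z := Finsupp.filter_add_filter_not _ _
    have hs₁ : z₁ ∈ Finsupp.supported (ZMod 2) (ZMod 2)
        {σ | σ.card = m ∧ R a ⊆ σ ∧ σ ⊆ C a} := by
      intro σ hσ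
      rw [hz₁, Finsupp.support_filter, Finset.coe_filter] at hσ
      exact ⟨(hz hσ.1).1, hσ.2⟩
    have hs₂ : z₂ ∈ Finsupp.supported (ZMod 2) (ZMod 2)
        {σ | σ.card = m ∧ ∃ i ∈ D, σ ⊆ C i} := by
      intro σ hσ
      rw [hz₂, Finsupp.support_filter, Finset.coe_filter] at hσ
      obtain ⟨hc, i, hi, hσi⟩ := hz hσ.1
      refine ⟨hc, ?_⟩
      rcases Finset.mem_insert.1 hi with rfl | hi
      · exact holda σ hσi fun h => hσ.2 ⟨h, hσi⟩
      · exact ⟨i, hi, hσi⟩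
    by_cases hRC : C a ⊆ R a
    -- The only possible new face is `C a` itself, which has `n + 1 > m` vertices.
    · have : z₁ = 0 := by
        rw [← Finsupp.support_eq_empty, Finset.eq_empty_iff_forall_notMem]
        intro σ hσ
        obtain ⟨hc, h, -⟩ := hs₁ hσ
        have := Finset.card_le_card (hRC.trans h)
        rw [hC] at this
        omega
      rw [this, zero_add] at hz₁₂
      obtain ⟨y, hy, e⟩ := ih (hz₁₂ ▸ hs₂) hz0
      exact ⟨y, hmono _ hy, e⟩
    · obtain ⟨v, hvC, hvR⟩ := Finset.not_subset.1 hRC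
      have hb : simplexBoundary z₁ = simplexBoundary z₂ := by
        rw [← sub_eq_zero, ← hz0, ← hz₁₂, map_add, sub_eq_add_neg,
          neg_eq_of_add_eq_zero_left (chain_add_self _)]
      -- Being also the boundary of `z₂`, the boundary of `z₁` is supported on old faces of `C a`.
      have hb₁ : simplexBoundary z₁ ∈ Finsupp.supported (ZMod 2) (ZMod 2)
          {σ | σ.card + 1 = m ∧ σ ⊆ C a ∧ ∃ i ∈ D, σ ⊆ C i} := by
        have h₁ := simplexBoundary_mem_supported (A' := {σ | σ ⊆ C a})
          (fun σ hσ v _ => (Finset.erase_subset v σ).trans hσ.2.2) hs₁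
        have h₂ := simplexBoundary_mem_supported
          (A' := {σ | σ.card + 1 = m ∧ ∃ i ∈ D, σ ⊆ C i}) (fun σ hσ v hv =>
            ⟨by rw [Finset.card_erase_add_one hv, hσ.1],
              hσ.2.imp fun i hi => ⟨hi.1, (Finset.erase_subset v σ).trans hi.2⟩⟩) hs₂
        rw [← hb] at h₂
        exact fun σ hσ => ⟨(h₂ hσ).1, h₁ hσ, (h₂ hσ).2⟩
      -- Since `v ∉ R a`, adding `v` to an old face of `C a` does not make it contain `R a`, so the
      -- cone stays among old faces. Hence `z₂` plus this cone is an old cycle that differs from `z`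
      -- by the boundary of the cone on `z₁`.
      have hs₃ := simplexCone_mem_supported (v := v)
        (A := {σ | σ.card + 1 = m ∧ σ ⊆ C a ∧ ∃ i ∈ D, σ ⊆ C i})
        (A' := {σ | σ.card = m ∧ ∃ i ∈ D, σ ⊆ C i}) (fun σ ⟨hc, hσa, i, hi, hσi⟩ hv =>
          ⟨by rw [Finset.card_insert_of_notMem hv, hc],
            holda _ (Finset.insert_subset hvC hσa) fun h => hnewa σ hσa i hi hσi
              ((Finset.subset_insert_iff_of_notMem hvR).1 h)⟩) hb₁
      have hs₄ := simplexCone_mem_supported (v := v)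
        (A' := {σ | σ.card = m + 1 ∧ ∃ i ∈ insert a D, σ ⊆ C i}) (fun σ hσ hv =>
          ⟨by rw [Finset.card_insert_of_notMem hv, hσ.1],
            a, Finset.mem_insert_self _ _, Finset.insert_subset hvC hσ.2.2⟩) hs₁
      have hh := simplexBoundary_cone_add v z₁
      obtain ⟨y, hy, e⟩ := ih (z := z₂ + simplexCone v (simplexBoundary z₁))
        (add_mem hs₂ hs₃) (by
          have := congrArg simplexBoundary hh
          rw [map_add, simplexBoundary_boundary, zero_add] at this
          rw [map_add, this, hb, chain_add_self])
      refine ⟨simplexCone v z₁ + y, add_mem hs₄ (hmono _ hy), ?_⟩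
      rw [map_add, e, ← hz₁₂]
      nth_rewrite 3 [← hh]
      abel

end Shelling

/-! ### From chains on finite sets to reduced homology -/

namespace PreAbstractSimplicialComplex

variable {V : Type u} (K : PreAbstractSimplicialComplex V)

open Classical in
theorem simplexBoundary_mapDomain {i j : ℤ} (h : j + 1 = i) (c : K.Chain i) :
    simplexBoundary (c.mapDomain Subtype.val) = (K.boundary i j h c).mapDomain Subtype.val := by
  suffices H : simplexBoundary ∘ₗ Finsupp.lmapDomain (ZMod 2) (ZMod 2) Subtype.val =
      Finsupp.lmapDomain (ZMod 2) (ZMod 2) Subtype.val ∘ₗ K.boundary i j h from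
    LinearMap.congr_fun H c
  refine Finsupp.lhom_ext' fun σ => LinearMap.ext_ring ?_
  simp only [LinearMap.comp_apply, Finsupp.lsingle_apply, Finsupp.lmapDomain_apply,
    Finsupp.mapDomain_single, simplexBoundary_single, boundary, Finsupp.linearCombination_single,
    one_smul]
  rw [← Finsupp.lmapDomain_apply (ZMod 2) (ZMod 2), map_sum]
  simp only [Finsupp.lmapDomain_apply, Finsupp.mapDomain_single, facet]
  exact (Finset.sum_coe_sort σ.1 fun v => Finsupp.single (σ.1.erase v) (1 : ZMod 2)).symm

/-- A finite shellable complex of dimension `n` has no reduced homology below degree `n`. -/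
theorem subsingleton_reducedHomology_of_shelling {ι : Type*} {C R : ι → Finset V} {ℓ : ι → ℕ}
    {n : ℕ} (hC : ∀ i, (C i).card = n + 1) {D : Finset ι} (hne : D.Nonempty)
    (hK : ∀ σ, σ ∈ K.faces ↔ σ.Nonempty ∧ ∃ i ∈ D, σ ⊆ C i)
    (hold : ∀ i ∈ D, ∀ σ ⊆ C i, ¬ R i ⊆ σ → ∃ j ∈ D, ℓ j < ℓ i ∧ σ ⊆ C j)
    (hnew : ∀ i ∈ D, ∀ j ∈ D, j ≠ i → ℓ j ≤ ℓ i → ∀ σ ⊆ C i, σ ⊆ C j → ¬ R i ⊆ σ)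
    {i : ℤ} (hi : i ≤ (n : ℤ) - 1) : Subsingleton (K.ReducedHomology i) := by
  classical
  have hface : ∀ σ, (σ = ∅ ∨ σ ∈ K.faces) ↔ ∃ i ∈ D, σ ⊆ C i := by
    intro σ
    rw [hK]
    constructor
    · rintro (rfl | h)
      · exact hne.imp fun i hi => ⟨hi, Finset.empty_subset _⟩
      · exact h.2
    · intro h
      exact σ.eq_empty_or_nonempty.imp id fun hσ => ⟨hσ, h⟩
  rw [Submodule.Quotient.subsingleton_iff, eq_top_iff]
  rintro ⟨z, hz⟩ -
  change z ∈ K.boundaries i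
  -- Below degree `-1` there are no simplices. Otherwise an `i`-simplex has `m = i + 1` vertices,
  -- and `m = 0` is the empty simplex.
  rcases lt_or_ge i (-1) with hlt | hge
  · have : z = 0 := by
      ext σ
      have := σ.2.2
      omega
    rw [this]
    exact zero_mem _
  obtain ⟨m, hm⟩ := Int.eq_ofNat_of_zero_le (by omega : 0 ≤ i + 1)
  have hz' : K.boundary i (i - 1) (by ring) z = 0 := hz
  have hs : z.mapDomain Subtype.val ∈ Finsupp.supported (ZMod 2) (ZMod 2)
      {σ | σ.card = m ∧ ∃ i ∈ D, σ ⊆ C i} := by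
    intro σ hσ
    obtain ⟨τ, -, rfl⟩ := Finset.mem_image.1 (Finsupp.mapDomain_support hσ)
    exact ⟨by have := τ.2.2; omega, (hface _).1 τ.2.1⟩
  obtain ⟨y, hy, e⟩ := exists_simplexBoundary_eq hC hold hnew (by omega : m ≤ n) hs
    (by rw [K.simplexBoundary_mapDomain (by ring : i - 1 + 1 = i), hz', Finsupp.mapDomain_zero])
  obtain ⟨y', rfl⟩ : ∃ y' : K.Chain (i + 1), y'.mapDomain Subtype.val = y := by
    refine ⟨y.comapDomain Subtype.val Subtype.val_injective.injOn,
      Finsupp.mapDomain_comapDomain _ Subtype.val_injective _ fun σ hσ => ?_⟩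
    obtain ⟨hc, h⟩ := hy hσ
    exact ⟨⟨σ, (hface σ).2 h, by omega⟩, rfl⟩
  rw [K.simplexBoundary_mapDomain rfl] at e
  exact ⟨y', Finsupp.mapDomain_injective Subtype.val_injective e⟩

end PreAbstractSimplicialComplex

/-! ### Parabolic subgroups, retractions and fixed chambers -/

namespace BNPair

variable {G : Type u} [Group G] (P : BNPair G)

theorem exists_mem_cell_mul {J : Set P.S} {w : P.Weyl} {g y : G} (hg : g ∈ P.cell w)
    (hy : y ∈ P.parabolic J) : ∃ u ∈ P.weylParabolic J, g * y ∈ P.cell (w * u) := by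
  obtain ⟨u, hu, hyu⟩ := P.mem_parabolic_iff.1 hy
  have hJ : ∀ s ∈ Subtype.val '' J, s ∈ P.S := by rintro _ ⟨s, -, rfl⟩; exact s.2
  obtain ⟨l, hl, rfl, -⟩ :=
    exists_word (fun s hs => P.isInvolutiveGenerating.mul_self s (hJ s hs)) hu
  clear hu hy
  induction l generalizing w g y with
  | nil =>
    exact ⟨1, one_mem _, by simpa using P.right_mul_mem_cell hg (P.mem_cell_one_iff.1 hyu)⟩
  | cons s l ih =>
    simp only [List.mem_cons, forall_eq_or_imp] at hl
    rw [List.prod_cons] at hyu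
    obtain ⟨x, hx, y, hy, rfl⟩ := P.exists_mul_eq hyu
    rw [← mul_assoc]
    rcases P.mul_mem_cell_or' (hJ s hl.1) hx hg with h | h
    · obtain ⟨u, hu, h'⟩ := ih h hl.2 hy
      exact ⟨s * u, (P.weylParabolic J).mul_mem (Subgroup.subset_closure hl.1) hu,
        by rwa [← mul_assoc]⟩
    · exact ih h hl.2 hy

/-- Lengths add along a reduced word of `u`, so each letter multiplies cells without branching. -/
theorem mul_mem_cell_of_no_descent {J : Set P.Weyl} (hJ : J ⊆ P.S) {w u : P.Weyl}
    (hw : ∀ s ∈ J, wordLength P.S w < wordLength P.S (w * s)) (hu : u ∈ Subgroup.closure J)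
    {g x : G} (hg : g ∈ P.cell w) (hx : x ∈ P.cell u) : g * x ∈ P.cell (w * u) := by
  have hF := P.isFolding
  have hmin := hF.length_minimal_of_no_descent hJ hw
  obtain ⟨l, hl, rfl, hlen⟩ := exists_word (fun s hs => hF.mul_self s (hJ hs)) hu
  have hadd := hF.length_minimal_mul_prod hJ hmin l hl hlen.symm
  clear hu hlen
  induction l using List.reverseRecOn generalizing x with
  | nil =>
    simpa using P.right_mul_mem_cell hg (P.mem_cell_one_iff.1 hx)
  | append_singleton l t ih =>
    simp only [List.mem_append, List.mem_singleton] at hl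
    have hl' : ∀ x ∈ l, x ∈ J := fun x hx => hl x (.inl hx)
    have ht : t ∈ J := hl t (.inr rfl)
    simp only [List.prod_append, List.prod_singleton, List.length_append, List.length_singleton,
      ← mul_assoc] at hx hadd ⊢
    obtain ⟨y, hy, z, hz, rfl⟩ := P.exists_mul_eq hx
    have h₁ := hF.length_mul_le' (hJ ht) (w * l.prod)
    have h₂ := hF.length_minimal_mul hJ hmin (u := l.prod)
      (Subgroup.list_prod_mem _ fun x hx => Subgroup.subset_closure (hl' x hx))
    have h₃ := wordLength_le hl'
    rw [← mul_assoc]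
    exact P.mul_mem_cell_of_length_le' (hJ ht) (by omega) hz (ih hl' hy (by omega))

theorem image_val_subset (J : Set P.S) : Subtype.val '' J ⊆ P.S := by
  rintro _ ⟨s, -, rfl⟩
  exact s.2

/-- An element of `B` fixing the face `n G_J` fixes its chamber nearest to the base chamber. -/
theorem conj_mem_of_no_descent {J : Set P.S} {n : P.N}
    (hn : ∀ s ∈ J, wordLength P.S (n : P.Weyl) < wordLength P.S ((n : P.Weyl) * s)) {c : G}
    (hc : c ∈ P.B) (h : (n : G)⁻¹ * (c * n) ∈ P.parabolic J) : (n : G)⁻¹ * (c * n) ∈ P.B := by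
  obtain ⟨u, hu, hx⟩ := P.mem_parabolic_iff.1 h
  have h₁ := P.mul_mem_cell_of_no_descent (P.image_val_subset J)
    (by rintro _ ⟨s, hs, rfl⟩; exact hn s hs) hu (P.coe_mem_cell n) hx
  rw [mul_inv_cancel_left] at h₁
  -- The element `c * n` lies in the cells of both `n` and `n * u`, hence `u = 1`.
  have := P.cell_unique h₁ (P.left_mul_mem_cell hc (P.coe_mem_cell n))
  rw [mul_eq_left] at this
  rw [this] at hx
  exact P.mem_cell_one_iff.1 hx

theorem mem_weylParabolic_compl {T : Set P.S} {u : P.Weyl}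
    (hu : ∀ s ∈ T, u ∈ P.weylParabolic {s}ᶜ) : u ∈ P.weylParabolic Tᶜ := by
  have := P.isFolding.mem_closure_iInter (ι := T) (I := fun s => Subtype.val '' {s.1}ᶜ)
    (fun s => P.image_val_subset _) (fun s => hu s s.2)
  refine Subgroup.closure_mono ?_ this
  rintro s ⟨hs, hsI⟩
  refine ⟨⟨s, hs⟩, fun hT => ?_, rfl⟩
  obtain ⟨t, ht, e⟩ := hsI ⟨_, hT⟩
  exact ht (Subtype.ext e)

theorem coe_mem_parabolic_iff {J : Set P.S} {n : P.N} :
    (n : G) ∈ P.parabolic J ↔ (n : P.Weyl) ∈ P.weylParabolic J := by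
  rw [mem_parabolic_iff]
  constructor
  · rintro ⟨w, hw, h⟩
    rwa [P.cell_unique (P.coe_mem_cell n) h]
  · exact fun h => ⟨n, h, P.coe_mem_cell n⟩

theorem mem_parabolic_of_mem_B (J : Set P.S) {b : G} (hb : b ∈ P.B) : b ∈ P.parabolic J :=
  P.mem_parabolic_iff.2 ⟨1, one_mem _, P.mem_cell_one_iff.2 hb⟩

theorem mem_parabolic_compl {T : Set P.S} {g : G} (hg : ∀ s ∈ T, g ∈ P.parabolic {s}ᶜ) :
    g ∈ P.parabolic Tᶜ := by
  obtain ⟨w, hw⟩ := P.exists_mem_cell g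
  refine P.mem_parabolic_iff.2 ⟨w, P.mem_weylParabolic_compl fun s hs => ?_, hw⟩
  obtain ⟨v, hv, hgv⟩ := P.mem_parabolic_iff.1 (hg s hs)
  rwa [P.cell_unique hw hgv]

theorem mem_B_of_forall_mem_parabolic {g : G} (hg : ∀ s : P.S, g ∈ P.parabolic {s}ᶜ) :
    g ∈ P.B := by
  obtain ⟨w, hw, h⟩ := P.mem_parabolic_iff.1 (P.mem_parabolic_compl (T := Set.univ) fun s _ => hg s)
  rw [weylParabolic, Set.compl_univ, Set.image_empty, Subgroup.closure_empty,
    Subgroup.mem_bot] at hw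
  rw [hw] at h
  exact P.mem_cell_one_iff.1 h

theorem vertex_eq_iff {g h : G} {s : P.S} :
    P.vertex g s = P.vertex h s ↔ g⁻¹ * h ∈ P.parabolic {s}ᶜ := by
  rw [← QuotientGroup.eq]
  simp [vertex]

theorem vertex_coe_eq_iff {x : G} {n m : P.N} {s : P.S} :
    P.vertex (x * n) s = P.vertex (x * m) s ↔
      (n : P.Weyl)⁻¹ * (m : P.Weyl) ∈ P.weylParabolic {s}ᶜ := by
  rw [vertex_eq_iff, ← QuotientGroup.mk_inv, ← QuotientGroup.mk_mul, ← coe_mem_parabolic_iff]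
  simp [mul_assoc]

/-- The retraction onto an apartment centred at a chamber is well defined on vertices. -/
theorem vertex_eq_of_vertex_mul_eq {x c : G} (hc : c ∈ P.B) {n m : P.N} {s : P.S}
    (h : P.vertex (x * n) s = P.vertex (x * (c * m)) s) :
    P.vertex (x * n) s = P.vertex (x * m) s := by
  rw [vertex_eq_iff] at h
  simp only [mul_inv_rev, mul_assoc, inv_mul_cancel_left] at h
  obtain ⟨u, hu, hu'⟩ := P.exists_mem_cell_mul (P.coe_mem_cell n) h
  rw [mul_inv_cancel_left] at hu'
  rw [vertex_coe_eq_iff, P.cell_unique (P.left_mul_mem_cell hc (P.coe_mem_cell m)) hu']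
  simpa using hu

theorem vertex_mul_of_mem_B {g b : G} (hb : b ∈ P.B) (s : P.S) :
    P.vertex (g * b) s = P.vertex g s := by
  rw [eq_comm, vertex_eq_iff, inv_mul_cancel_left]
  exact P.mem_parabolic_of_mem_B _ hb

theorem fst_eq_of_vertex_eq {g h : G} {s t : P.S} (e : P.vertex g s = P.vertex h t) : s = t :=
  congrArg Sigma.fst e

/-- A simplex of the building with all vertices in an apartment lies in a chamber of it. -/
theorem exists_chamber_of_subset {σ : Set P.Vertex} {h x : G} (hσ : σ ⊆ P.chamber h)
    (hσx : σ ⊆ P.apartmentVertices x) : ∃ n : P.N, σ ⊆ P.chamber (x * n) := by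
  -- With `x⁻¹ * h = b * n * c`, the retraction onto `A_x` centred at `x` carries the chamber of `h`
  -- to that of `x * n` and fixes the vertices of `σ`.
  obtain ⟨w, hw⟩ := P.exists_mem_cell (x⁻¹ * h)
  obtain ⟨n, rfl, b, hb, c, hc, e⟩ := P.mem_cell_iff.1 hw
  refine ⟨n, fun v hv => ?_⟩
  obtain ⟨s, rfl⟩ := hσ hv
  obtain ⟨m, t, ht⟩ := hσx hv
  obtain rfl := P.fst_eq_of_vertex_eq ht
  rw [inv_mul_eq_iff_eq_mul] at e
  have h₁ : P.vertex h s = P.vertex (x * (b * n)) s := by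
    rw [e, ← mul_assoc, P.vertex_mul_of_mem_B hc]
  rw [ht] at h₁ ⊢
  exact ⟨s, (P.vertex_eq_of_vertex_mul_eq hb h₁).symm⟩

theorem apartmentVertices_mul_coe (g : G) (n : P.N) :
    P.apartmentVertices (g * n) = P.apartmentVertices g := by
  ext v
  constructor
  · rintro ⟨m, s, rfl⟩
    exact ⟨n * m, s, by simp [mul_assoc]⟩
  · rintro ⟨m, s, rfl⟩
    exact ⟨n⁻¹ * m, s, by simp [mul_assoc]⟩

theorem exists_apartmentVertices_eq {h g : G} (hg : P.chamber h ⊆ P.apartmentVertices g) :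
    ∃ b ∈ P.B, P.apartmentVertices g = P.apartmentVertices (h * b) := by
  obtain ⟨n, hn⟩ := P.exists_chamber_of_subset subset_rfl hg
  refine ⟨h⁻¹ * (g * n), P.mem_B_of_forall_mem_parabolic fun s => ?_, ?_⟩
  · obtain ⟨t, ht⟩ := hn ⟨s, rfl⟩
    obtain rfl := P.fst_eq_of_vertex_eq ht
    exact P.vertex_eq_iff.1 ht.symm
  · rw [mul_inv_cancel_left, apartmentVertices_mul_coe]

/-- A simplex fixed by elements `c j` of `B` lies in a chamber fixed by them. -/
theorem exists_fixed_chamber {ι : Type*} {c : ι → G} (hc : ∀ j, c j ∈ P.B) {x : G} {n : P.N}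
    {T : Set P.S} (hT : ∀ j, ∀ s ∈ T, P.vertex (x * n) s ∈ P.apartmentVertices (x * c j)) :
    ∃ m : P.N, (∀ j, (m : G)⁻¹ * (c j * m) ∈ P.B) ∧
      ∀ s ∈ T, P.vertex (x * n) s = P.vertex (x * m) s := by
  -- Among the chambers `x w` with the given vertices of types in `T`, take one nearest to `x`.
  obtain ⟨v, hv, hmin⟩ := exists_length_minimal P.S (Subtype.val '' Tᶜ) (n : P.Weyl)
  obtain ⟨m, rfl⟩ := QuotientGroup.mk_surjective v
  have hnm : ∀ s ∈ T, P.vertex (x * n) s = P.vertex (x * m) s := by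
    intro s hs
    rw [eq_comm, vertex_coe_eq_iff]
    exact Subgroup.closure_mono (Set.image_mono (Set.compl_subset_compl.2
      (Set.singleton_subset_iff.2 hs))) hv
  refine ⟨m, fun j => P.conj_mem_of_no_descent (J := Tᶜ) (fun s hs => ?_) (hc j)
    (P.mem_parabolic_compl fun s hs => ?_), hnm⟩
  · exact lt_of_le_of_ne (hmin s (Subgroup.subset_closure ⟨s, hs, rfl⟩))
      (P.isFolding.length_ne' s.2 _).symm
  · obtain ⟨p, t, hp⟩ := hT j s hs
    obtain rfl := P.fst_eq_of_vertex_eq hp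
    rw [hnm s hs] at hp
    -- Retraction shows that the vertex, known in `A_{x c_j}` as `x c_j p`, has the same label `p`
    -- in `A_x`. So `x c_j x⁻¹` fixes it.
    have h₁ : P.vertex (x * m) s = P.vertex (x * p) s :=
      P.vertex_eq_of_vertex_mul_eq (hc j) (by rwa [mul_assoc] at hp)
    have h₂ := (P.vertex_coe_eq_iff (x := x * c j)).2 (P.vertex_coe_eq_iff.1 h₁.symm)
    have h₃ := P.vertex_eq_iff.1 (hp.trans h₂)
    rwa [mul_inv_rev, mul_assoc, mul_assoc, inv_mul_cancel_left] at h₃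

end BNPair

/-! ### The shelling of an intersection of apartments -/

theorem PreAbstractSimplicialComplex.mem_faces_iInf {V : Type*} {ι : Type*} [Nonempty ι]
    {K : ι → PreAbstractSimplicialComplex V} {σ : Finset V} :
    σ ∈ (⨅ j, K j).faces ↔ ∀ j, σ ∈ (K j).faces := by
  constructor
  · exact fun h j => iInf_le K j h
  · intro h
    refine ⟨?_, ((K (Classical.arbitrary ι)).isRelLowerSet_faces (h _)).1⟩
    simpa using h

namespace BNPair

variable {G : Type u} [Group G] (P : BNPair G)

theorem mem_faces_iInf_apartment {ι : Type*} [Nonempty ι] {g : ι → G} {σ : Finset P.Vertex} :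
    σ ∈ (⨅ j, P.apartment (g j)).faces ↔ σ.Nonempty ∧ (∃ h, (σ : Set P.Vertex) ⊆ P.chamber h) ∧
      ∀ j, (σ : Set P.Vertex) ⊆ P.apartmentVertices (g j) := by
  rw [PreAbstractSimplicialComplex.mem_faces_iInf]
  constructor
  · exact fun h => ⟨(h (Classical.arbitrary ι)).1.1, (h (Classical.arbitrary ι)).1.2,
      fun j => (h j).2⟩
  · exact fun h j => ⟨⟨h.1, h.2.1⟩, h.2.2 j⟩

theorem vertex_injective (g : G) : Function.Injective (P.vertex g) :=
  fun _ _ => P.fst_eq_of_vertex_eq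

/-- The representative in `N` of an element of the Weyl group. -/
noncomputable def lift (w : P.Weyl) : P.N := Quotient.out w

theorem coe_lift (w : P.Weyl) : (P.lift w : P.Weyl) = w := Quotient.out_eq w

theorem vertex_lift_eq_iff {x : G} {w v : P.Weyl} {s : P.S} :
    P.vertex (x * P.lift w) s = P.vertex (x * P.lift v) s ↔ w⁻¹ * v ∈ P.weylParabolic {s}ᶜ := by
  rw [vertex_coe_eq_iff, coe_lift, coe_lift]

/-- The chambers `x w` fixed by elements `c j` of `B` form a shellable complex. -/
theorem subsingleton_reducedHomology [Finite G] [Finite P.S] {n : ℕ} (hrank : P.rank = n + 1)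
    {ι : Type*} [Nonempty ι] {g c : ι → G} {x : G} (hc : ∀ j, c j ∈ P.B) {j₀ : ι} (hj₀ : c j₀ = 1)
    (hg : ∀ j, P.apartmentVertices (g j) = P.apartmentVertices (x * c j)) {i : ℤ}
    (hi : i ≤ (n : ℤ) - 1) : Subsingleton ((⨅ j, P.apartment (g j)).ReducedHomology i) := by
  classical
  have := Fintype.ofFinite P.S
  have := Fintype.ofFinite P.Weyl
  have hF := P.isFolding
  -- Two representatives of `w` in `N` differ by an element of `B`, so being fixed depends on `w`
  -- alone.
  have hfix : ∀ w : P.Weyl, ∀ n : P.N, (n : P.Weyl) = w → ∀ b : G,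
      (n : G)⁻¹ * (b * n) ∈ P.B → (P.lift w : G)⁻¹ * (b * P.lift w) ∈ P.B := by
    rintro w n hn b hb
    have h₁ : (n : G)⁻¹ * P.lift w ∈ P.B := by
      have : ((n⁻¹ * P.lift w : P.N) : P.Weyl) = 1 := by
        rw [QuotientGroup.mk_mul, QuotientGroup.mk_inv, coe_lift, hn, inv_mul_cancel]
      simpa using P.coe_eq_one_iff.1 this
    have := P.B.mul_mem (P.B.mul_mem (P.B.inv_mem h₁) hb) h₁
    simpa [mul_assoc] using this
  set C : P.Weyl → Finset P.Vertex := fun w => Finset.univ.image (P.vertex (x * P.lift w)) with hC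
  have hCmem : ∀ w v, v ∈ C w ↔ ∃ s, P.vertex (x * P.lift w) s = v := by simp [hC]
  have hCsub : ∀ w (σ : Finset P.Vertex), σ ⊆ C w ↔ (σ : Set P.Vertex) ⊆ P.chamber (x * P.lift w) :=
    fun w σ => ⟨fun h v hv => (hCmem w v).1 (h hv), fun h v hv => (hCmem w v).2 (h hv)⟩
  refine PreAbstractSimplicialComplex.subsingleton_reducedHomology_of_shelling _ (C := C)
    (R := fun w => (Finset.univ.filter fun s : P.S =>
      wordLength P.S (w * s) < wordLength P.S w).image (P.vertex (x * P.lift w)))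
    (ℓ := wordLength P.S) (n := n)
    (D := Finset.univ.filter fun w => ∀ j, (P.lift w : G)⁻¹ * (c j * P.lift w) ∈ P.B)
    (fun w => ?_) ⟨1, ?_⟩ (fun σ => ?_) ?_ ?_ hi
  · rw [Finset.card_image_of_injective _ (P.vertex_injective _), Finset.card_univ, ← hrank, rank,
      Nat.card_eq_fintype_card]
  · exact Finset.mem_filter.2 ⟨Finset.mem_univ _, fun j => hfix 1 1 rfl _ (by simpa using hc j)⟩
  · rw [mem_faces_iInf_apartment]
    refine and_congr_right fun hne => ⟨?_, ?_⟩
    · rintro ⟨⟨h, hσh⟩, hσ⟩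
      simp only [hg] at hσ
      obtain ⟨m, hm⟩ := P.exists_chamber_of_subset hσh (x := x) (by simpa [hj₀] using hσ j₀)
      -- A chamber of `A_x` containing `σ` need not be fixed; it is replaced by a fixed one with the
      -- same vertices in `σ`.
      obtain ⟨p, hp, hmp⟩ := P.exists_fixed_chamber hc (x := x) (n := m)
        (T := {s | P.vertex (x * m) s ∈ σ}) (fun j s hs => hσ j hs)
      refine ⟨p, Finset.mem_filter.2 ⟨Finset.mem_univ _, fun j => hfix p p rfl _ (hp j)⟩, ?_⟩
      intro v hv
      obtain ⟨s, rfl⟩ := hm hv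
      rw [hCmem]
      refine ⟨s, ?_⟩
      rw [hmp s hv, vertex_coe_eq_iff, coe_lift, inv_mul_cancel]
      exact one_mem _
    · rintro ⟨w, hw, hσ⟩
      rw [hCsub] at hσ
      refine ⟨⟨_, hσ⟩, fun j v hv => ?_⟩
      obtain ⟨s, rfl⟩ := hσ hv
      rw [hg]
      refine ⟨P.lift w, s, ?_⟩
      rw [← P.vertex_mul_of_mem_B ((Finset.mem_filter.1 hw).2 j)]
      simp [mul_assoc]
  · intro w hw σ hσ hR
    obtain ⟨v, hv, hvσ⟩ := Finset.not_subset.1 hR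
    obtain ⟨s, hs, rfl⟩ := Finset.mem_image.1 hv
    have hlt := (Finset.mem_filter.1 hs).2
    -- A face missing the vertex of a descent type `s` also lies in the adjacent shorter chamber `w
    -- * s`. The elements fixing `w` fix the common panel, and hence its nearest chamber `w * s`.
    refine ⟨w * s, Finset.mem_filter.2 ⟨Finset.mem_univ _, fun j => ?_⟩, hlt, ?_⟩
    · refine P.conj_mem_of_no_descent (J := {s}) ?_ (hc j) ?_
      · intro t ht
        rw [Set.mem_singleton_iff.1 ht, coe_lift, mul_assoc, hF.mul_self _ s.2, mul_one]
        exact hlt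
      · have h₁ : ((P.lift w)⁻¹ * P.lift (w * s) : P.N) ∈ (P.parabolic {s}).subgroupOf P.N := by
          rw [Subgroup.mem_subgroupOf, coe_mem_parabolic_iff, QuotientGroup.mk_mul,
            QuotientGroup.mk_inv, coe_lift, coe_lift, inv_mul_cancel_left]
          exact Subgroup.subset_closure ⟨s, rfl, rfl⟩
        rw [Subgroup.mem_subgroupOf] at h₁
        have h₂ := P.mem_parabolic_of_mem_B {s} ((Finset.mem_filter.1 hw).2 j)
        have := (P.parabolic {s}).mul_mem
          ((P.parabolic {s}).mul_mem ((P.parabolic {s}).inv_mem h₁) h₂) h₁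
        simpa [mul_assoc] using this
    · intro u hu
      obtain ⟨t, rfl⟩ := (hCmem w u).1 (hσ hu)
      rw [hCmem]
      refine ⟨t, ?_⟩
      rw [eq_comm, vertex_lift_eq_iff, inv_mul_cancel_left]
      refine Subgroup.subset_closure ⟨s, ?_, rfl⟩
      rintro rfl
      exact hvσ hu
  · intro w hw v hv hne hle σ hσw hσv hR
    -- A common face with type set `T` puts `v` in `w W_J` for `J = Tᶜ`. If it contains every
    -- descent vertex of `w`, then `w` has no descent in `J` and is strictly shorter than `v`.
    have hmem : w⁻¹ * v ∈ P.weylParabolic {s | P.vertex (x * P.lift w) s ∈ σ}ᶜ := by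
      refine P.mem_weylParabolic_compl fun s hs => ?_
      obtain ⟨t, ht⟩ := (hCmem v _).1 (hσv hs)
      obtain rfl := P.fst_eq_of_vertex_eq ht
      exact P.vertex_lift_eq_iff.1 ht.symm
    have hlt := hF.length_lt_of_no_descent (P.image_val_subset _) (w := w) (fun s hs => ?_) hmem
      (fun e => hne (inv_mul_eq_one.1 e).symm)
    · rw [mul_inv_cancel_left] at hlt
      exact absurd hle hlt.not_ge
    · obtain ⟨s, hs, rfl⟩ := hs
      refine lt_of_le_of_ne (not_lt.1 fun hlt => hs ?_) (hF.length_ne' s.2 w).symm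
      exact hR (Finset.mem_image.2 ⟨s, Finset.mem_filter.2 ⟨Finset.mem_univ _, hlt⟩, rfl⟩)

end BNPair

theorem claim3p3 {G : Type*} [Group G] [Finite G] (P : BNPair G) (n : ℕ) (hrank : P.rank = n + 1)
    (k : ℕ) (hk : 1 ≤ k) (g : Fin k → G) (hdim : (⨅ j, P.apartment (g j)).HasDim (n : ℤ))
    (i : ℤ) (hi : i ≤ (n : ℤ) - 1) :
    Subsingleton ((⨅ j, P.apartment (g j)).ReducedHomology i) := by
  classical
  have : Nonempty (Fin k) := ⟨⟨0, hk⟩⟩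
  have hfin : Finite P.S := Nat.finite_of_card_ne_zero (by
    rw [← BNPair.rank, hrank]; exact Nat.succ_ne_zero n)
  have := Fintype.ofFinite P.S
  obtain ⟨σ, hσ, hcard⟩ := hdim.1
  obtain ⟨-, ⟨h, hσh⟩, hσg⟩ := P.mem_faces_iInf_apartment.1 hσ
  -- A face of dimension `n` has `n + 1` vertices, as many as a chamber.
  have hchamber : P.chamber h ⊆ σ := by
    have hsub : σ ⊆ Finset.univ.image (P.vertex h) := fun v hv => by
      obtain ⟨s, rfl⟩ := hσh hv
      exact Finset.mem_image_of_mem _ (Finset.mem_univ s)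
    have heq := Finset.eq_of_subset_of_card_le hsub (by
      rw [Finset.card_image_of_injective _ (P.vertex_injective h), Finset.card_univ,
        ← Nat.card_eq_fintype_card, ← BNPair.rank, hrank]
      simp only at hcard
      omega)
    rw [heq]
    rintro _ ⟨s, rfl⟩
    simp
  choose b hb hgb using fun j => P.exists_apartmentVertices_eq (hchamber.trans (hσg j))
  let j₀ : Fin k := ⟨0, hk⟩
  -- Moving the base point by `b j₀` keeps the chamber and makes `A_x` the apartment of index `j₀`.
  refine P.subsingleton_reducedHomology hrank (x := h * b j₀) (c := fun j => (b j₀)⁻¹ * b j)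
    (fun j => P.B.mul_mem (P.B.inv_mem (hb _)) (hb j)) (j₀ := j₀) (inv_mul_cancel _)
    (fun j => ?_) hi
  rw [hgb j, mul_assoc, mul_inv_cancel_left]
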